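/- **Setting.** Let $N\ge 1$ and let $\mathcal H=\sum_u c_u P_u$ be an $N$-qubit spin Hamiltonian (real $c_u$, $P_u$ the Pauli strings). An analogue quantum simulation prepares $|\psi_0\rangle=\bigotimes_j\mathcal A'_j|0\rangle^{\otimes N}$, applies $e^{-i\mathcal Ht}$ ($t\in\mathbb R$), applies single-qubit gates $\bigotimes_j\mathcal D'_j$ and measures every qubit in the $Z$-basis. A hybrid quantum simulation (HQS) prepares $|0\rangle^{\otimes N}$, applies time evolutions under $\mathcal H$ interspersed with layers of single-qubit gates, and measures in the $Z$-basis. Two HQSs are in the same redaction class if they differ only in which gates are applied at the positions that carry gates; a reduced redaction class arises by removing the gates at some positions. The variation distance of an execution is $\nu=\frac12\sum_s|P(s)-\tilde P(s)|$, where $P$ and $\tilde P$ are the error-free and the actual outcome distributions; for a simulation with randomly chosen gates $\nu$ is averaged over the choice. **Simulations.** Let $G$ be a group of Pauli strings modulo phases, with $L=|G|\ge 2$, such that every non-identity term of $\mathcal H$ anticommutes with some element of $G$. Let $\epsilon>0$, $t_1'=t/L$, $t_2'=(L-1)t/L$ and $M=\big\lceil 2t_2'^2(\sum_u|c_u|)^2L/(\epsilon(L-1))\big\rceil$.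 The *target simulation* applies $\bigotimes_j\mathcal A'_j$, then $e^{-i\mathcal Ht_1'}$, then $M$ times $e^{-i\mathcal Ht_2'/M}$, then $\bigotimes_j\mathcal D'_j$. A *trap simulation* draws, uniformly and independently, a bit $h$, bits $z_j,z_j'$, Pauli gates $\mathcal P_j$ (for each qubit $j$) and $\sigma_1,\dots,\sigma_M\in G\setminus\{I\}$; it applies $\bigotimes_j\mathcal P_jH^hZ^{z_j}$ ($H$ the Hadamard gate), then $e^{-i\mathcal Ht_1'}$, then $\sigma_k e^{-i\mathcal Ht_2'/M}\sigma_k$ for $k=1,\dots,M$, then $\bigotimes_jZ^{z_j'}H^h\mathcal P_j$. Its outcome is correct if it is $0\cdots0$. Let $\eta$ be the probability that an error-free trap gives an incorrect outcome. **Error model.** (E1) An execution consists of the error-free parts of the simulation, with a CPTP map on the simulator and an environment after the preparation and after each part; errors in different simulations are independent, but they need not be identical. (E2) If $S'$ lies in a reduced redaction class of the class of $S$, then $\nu(\tilde S')\le\nu(\tilde S)$ for any executions; this is needed only for $S$ the randomly generated trap and $S'$ the target simulation. (E3) The errors in an execution depend on the redaction class of the simulation only. **Protocol.** Given also $\theta\in(0,1)$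 and $\alpha\in[0,1)$, let $N_{\mathrm{tr}}=\big\lceil\frac{2}{\theta^2}\ln\frac{2}{1-\alpha}\big\rceil+1$. Choose one of $N_{\mathrm{tr}}+1$ time slots uniformly at random, execute the target simulation in it and independently generated traps in all the others. Return the outcome of the target simulation and $\epsilon_{\mathrm{VD}}=2\cdot\#\{\text{incorrect traps}\}/(N_{\mathrm{tr}}+1)$. **Theorem.** A group $G$ as above exists, and for every such $G$ the error-free target simulation has the same outcome distribution as the given analogue quantum simulation, and $\eta\le\epsilon$. Assume E1–E3. Then the protocol performs accredited analogue quantum simulation with $N_{\mathrm{tr}}$ traps: $\epsilon_{\mathrm{VD}}\in[0,2)$, and, with $\beta_\tau$ the expectation of $\epsilon_{\mathrm{VD}}$ given that the target is in slot $\tau$ (that is, $\frac{2}{N_{\mathrm{tr}}+1}$ times the sum of the probabilities of an incorrect outcome of the traps in the other slots) and $\nu_\tau$ the ideal–actual variation distance of the target execution in slot $\tau$, one has $\nu_\tau\le\beta_\tau+\eta$ for every $\tau$; and with probability at least $\alpha$ over the run, with $\tau$ the slot of the target, $$|\epsilon_{\mathrm{VD}}-\beta_\tau|\le\theta\qquad\text{and}\qquad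 \nu_\tau\le\epsilon_{\mathrm{VD}}+\theta+\eta\quad(\le\epsilon_{\mathrm{VD}}+\theta+\epsilon).$$ In particular, if the traps invert the evolution exactly then $\eta=0$ and $\nu_\tau\le\epsilon_{\mathrm{VD}}+\theta$ with confidence $\alpha$. -/

import Mathlib

open scoped Kronecker Matrix ComplexOrder

noncomputable section

namespace AnalogueAccreditation

/-! ### Registers, Pauli strings, Hamiltonians -/

/-- Computational basis labels (and measurement outcomes) of an `N`-qubit register. -/
abbrev Reg (N : ℕ) := Fin N → Fin 2

/-- Operators on an `N`-qubit register. -/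
abbrev Op (N : ℕ) := Matrix (Reg N) (Reg N) ℂ

/-- Single-qubit gates. -/
abbrev Gate := Matrix.unitaryGroup (Fin 2) ℂ

/-- Tensor product `g 0 ⊗ ⋯ ⊗ g (N - 1)` of single-qubit operators. -/
def tensorOp {N : ℕ} (g : Fin N → Matrix (Fin 2) (Fin 2) ℂ) : Op N :=
  Matrix.of fun s s' => ∏ j, g j (s j) (s' j)

/-- Labels of the single-qubit Pauli operators:
`(0,0) ↦ I`, `(1,0) ↦ X`, `(0,1) ↦ Z`, `(1,1) ↦ Y`.
Addition of labels is multiplication of Pauli operators up to a phase in `{±1, ±i}`. -/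
abbrev Pauli := ZMod 2 × ZMod 2

/-- Labels of Pauli strings; the zero label is the identity string. -/
abbrev PauliString (N : ℕ) := Fin N → Pauli

/-- The (Hermitian) Pauli matrix with label `p`. -/
def pauliMatrix (p : Pauli) : Matrix (Fin 2) (Fin 2) ℂ :=
  if p = (0, 0) then 1
  else if p = (1, 0) then !![0, 1; 1, 0]
  else if p = (0, 1) then !![1, 0; 0, -1]
  else !![0, -Complex.I; Complex.I, 0]

theorem pauliMatrix_mem (p : Pauli) : pauliMatrix p ∈ Matrix.unitaryGroup (Fin 2) ℂ := by
  rw [Matrix.mem_unitaryGroup_iff]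
  unfold pauliMatrix
  split_ifs <;> ext i j <;> fin_cases i <;> fin_cases j <;>
    simp [Matrix.mul_apply, Matrix.star_apply]

/-- Pauli gates. -/
def pauliGate (p : Pauli) : Gate := ⟨pauliMatrix p, pauliMatrix_mem p⟩

/-- The Hadamard matrix. -/
def hadamardMatrix : Matrix (Fin 2) (Fin 2) ℂ :=
  ((Real.sqrt 2 : ℝ) : ℂ)⁻¹ • !![1, 1; 1, -1]

theorem hadamardMatrix_mem : hadamardMatrix ∈ Matrix.unitaryGroup (Fin 2) ℂ := by
  have h : (((Real.sqrt 2 : ℝ) : ℂ)⁻¹ * ((Real.sqrt 2 : ℝ) : ℂ)⁻¹) = 1 / 2 := by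
    rw [← mul_inv, ← Complex.ofReal_mul, Real.mul_self_sqrt (by norm_num)]
    norm_num
  rw [Matrix.mem_unitaryGroup_iff]
  ext i j
  fin_cases i <;> fin_cases j <;>
    simp [hadamardMatrix, Matrix.mul_apply, Matrix.star_apply, Fin.sum_univ_two, h] <;> norm_num

/-- The Hadamard gate. -/
def hadamardGate : Gate := ⟨hadamardMatrix, hadamardMatrix_mem⟩

/-- The operator of a Pauli string. -/
def pauliOp {N : ℕ} (u : PauliString N) : Op N := tensorOp fun j => pauliMatrix (u j)

/-- The spin Hamiltonian `∑ᵤ c u • Pᵤ` with real Pauli coefficients `c`. -/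
def hamiltonian {N : ℕ} (c : PauliString N → ℝ) : Op N := ∑ u, (c u : ℂ) • pauliOp u

/-- The time evolution `exp (-i H τ)`. -/
def evolution {N : ℕ} (c : PauliString N → ℝ) (τ : ℝ) : Op N :=
  NormedSpace.exp ((-(Complex.I * (τ : ℂ))) • hamiltonian c)

/-! ### Analogue and hybrid quantum simulations -/

/-- An analogue quantum simulation: Hamiltonian (through its Pauli coefficients), duration,
initial product state `⊗ⱼ prep j |0⟩`, and single-qubit measurements (apply `meas j` to qubit `j`,
then measure in the computational basis). -/
structure AQS (N : ℕ) where
  coeff : PauliString N → ℝ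
  t : ℝ
  prep : Fin N → Gate
  meas : Fin N → Gate

/-- The outcome distribution of an analogue quantum simulation. -/
def AQS.prob {N : ℕ} (A : AQS N) (s : Reg N) : ℝ :=
  ‖(tensorOp (fun j => (A.meas j : Matrix (Fin 2) (Fin 2) ℂ)) * evolution A.coeff A.t
      * tensorOp (fun j => (A.prep j : Matrix (Fin 2) (Fin 2) ℂ))) s 0‖ ^ 2

/-- A part of a hybrid quantum simulation: time evolution under its Hamiltonian for some duration,
or a layer of single-qubit gates. `none` means that no gate is applied to that qubit. -/
inductive HQSPart (N : ℕ) where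
  | evolve (τ : ℝ) : HQSPart N
  | gates (g : Fin N → Option Gate) : HQSPart N

/-- A hybrid quantum simulation: the register is prepared in `|0⋯0⟩`, the parts are applied in order
(so that the time stamp of a gate is the total duration of the evolutions before it), and every
qubit is measured in the computational basis. Other product states and other single-qubit
measurements are obtained with a first and a last layer of gates. -/
structure HQS (N : ℕ) where
  coeff : PauliString N → ℝ
  parts : List (HQSPart N)

/-- The single-qubit operator of an optional gate. -/
def optGate : Option Gate → Matrix (Fin 2) (Fin 2) ℂ
  | none => 1
  | some g => (g : Matrix (Fin 2) (Fin 2) ℂ)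

/-- The error-free operator of a part. -/
def HQSPart.op {N : ℕ} (c : PauliString N → ℝ) : HQSPart N → Op N
  | .evolve τ => evolution c τ
  | .gates g => tensorOp fun j => optGate (g j)

/-- The error-free operator of a list of parts, applied in order. -/
def partsOp {N : ℕ} (c : PauliString N → ℝ) : List (HQSPart N) → Op N
  | [] => 1
  | p :: ps => partsOp c ps * p.op c

/-- The error-free outcome distribution of a hybrid quantum simulation. -/
def HQS.idealProb {N : ℕ} (C : HQS N) (s : Reg N) : ℝ := ‖partsOp C.coeff C.parts s 0‖ ^ 2

/-! ### Redaction -/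

/-- A redacted part: for a layer of gates only the positions of the gates are known. -/
inductive RedactedPart (N : ℕ) where
  | evolve (τ : ℝ) : RedactedPart N
  | gates (b : Fin N → Bool) : RedactedPart N

/-- A redacted hybrid quantum simulation. It represents its redaction class, the set of all `C` with
`C.redact = D`. -/
structure RedactedHQS (N : ℕ) where
  coeff : PauliString N → ℝ
  parts : List (RedactedPart N)

/-- Hide which gate is applied at each position that carries a gate. -/
def HQSPart.redact {N : ℕ} : HQSPart N → RedactedPart N
  | .evolve τ => .evolve τ
  | .gates g => .gates fun j => (g j).isSome

/-- Redaction of a hybrid quantum simulation. -/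
def HQS.redact {N : ℕ} (C : HQS N) : RedactedHQS N := ⟨C.coeff, C.parts.map HQSPart.redact⟩

/-- The first part arises from the second by removing some (possibly no) gates. -/
def RedactedPart.IsReduced {N : ℕ} : RedactedPart N → RedactedPart N → Prop
  | .evolve τ', .evolve τ => τ' = τ
  | .gates b', .gates b => ∀ j, b' j = true → b j = true
  | _, _ => False

/-- `D'` is a reduced redaction class of `D`. -/
def RedactedHQS.IsReduced {N : ℕ} (D' D : RedactedHQS N) : Prop :=
  D'.coeff = D.coeff ∧ List.Forall₂ RedactedPart.IsReduced D'.parts D.parts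

/-! ### Errors -/

/-- The map `Φ ⊗ id` on `n × Fin k` induced by a linear map `Φ`. -/
def ampliation {n : Type} (k : ℕ) (Φ : Matrix n n ℂ →ₗ[ℂ] Matrix n n ℂ)
    (ρ : Matrix (n × Fin k) (n × Fin k) ℂ) : Matrix (n × Fin k) (n × Fin k) ℂ :=
  Matrix.of fun x y => Φ (Matrix.of fun i j => ρ (i, x.2) (j, y.2)) x.1 y.1

/-- Completely positive trace preserving maps on matrices indexed by `n`. -/
structure CPTPMap (n : Type) [Fintype n] where
  toMap : Matrix n n ℂ →ₗ[ℂ] Matrix n n ℂ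
  completelyPositive : ∀ (k : ℕ) (ρ : Matrix (n × Fin k) (n × Fin k) ℂ),
    ρ.PosSemidef → (ampliation k toMap ρ).PosSemidef
  tracePreserving : ∀ ρ : Matrix n n ℂ, (toMap ρ).trace = ρ.trace

/-- The error in one execution of a simulation: an environment in some initial state and CPTP maps
on simulator and environment. Map `0` acts after the preparation of `|0⋯0⟩`, map `k + 1` after
part number `k` of the simulation; the last one acts just before the measurement. -/
structure ErrorProcess (N : ℕ) where
  envDim : ℕ
  env : Matrix (Fin envDim) (Fin envDim) ℂ
  env_posSemidef : env.PosSemidef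
  env_trace : env.trace = 1
  err : ℕ → CPTPMap (Reg N × Fin envDim)

/-- Apply the parts in order, part number `k` being followed by error map `k + 1`. -/
def runParts {N d : ℕ} (c : PauliString N → ℝ) (err : ℕ → CPTPMap (Reg N × Fin d)) :
    List (HQSPart N) → ℕ → Matrix (Reg N × Fin d) (Reg N × Fin d) ℂ →
      Matrix (Reg N × Fin d) (Reg N × Fin d) ℂ
  | [], _, ρ => ρ
  | p :: ps, k, ρ =>
      runParts c err ps (k + 1)
        ((err (k + 1)).toMap
          ((p.op c ⊗ₖ (1 : Matrix (Fin d) (Fin d) ℂ)) * ρ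
            * (p.op c ⊗ₖ (1 : Matrix (Fin d) (Fin d) ℂ))ᴴ))

/-- The state of simulator and environment just before the measurement. -/
def finalState {N : ℕ} (C : HQS N) (E : ErrorProcess N) :
    Matrix (Reg N × Fin E.envDim) (Reg N × Fin E.envDim) ℂ :=
  runParts C.coeff E.err C.parts 0
    ((E.err 0).toMap (Matrix.single (0 : Reg N) (0 : Reg N) (1 : ℂ) ⊗ₖ E.env))

/-- The outcome distribution of the erroneous execution of `C` with errors `E`. -/
def actualProb {N : ℕ} (C : HQS N) (E : ErrorProcess N) (s : Reg N) : ℝ :=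
  ∑ e, (finalState C E (s, e) (s, e)).re

/-- The ideal-actual variation distance of the execution of `C` with errors `E`. -/
def variationDistance {N : ℕ} (C : HQS N) (E : ErrorProcess N) : ℝ :=
  (1 / 2) * ∑ s, |C.idealProb s - actualProb C E s|

/-- The errors that the device commits, for each time slot `i : Fin m` and each simulation that may be
executed in that slot. They may differ from slot to slot. -/
abbrev Noise (N m : ℕ) := Fin m → HQS N → ErrorProcess N

/-- The average of `f` over a finite type. -/
def average {Ω : Type} [Fintype Ω] (f : Ω → ℝ) : ℝ := (∑ ω, f ω) / Fintype.card Ω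

/-- The ideal-actual variation distance of an execution, in slot `i`, of a simulation whose gates are
chosen at random: one of the `S ω` is drawn uniformly, and the distance is averaged over the draw. -/
def meanVariationDistance {N m : ℕ} (noise : Noise N m) {Ω : Type} [Fintype Ω]
    (S : Ω → HQS N) (i : Fin m) : ℝ :=
  average fun ω => variationDistance (S ω) (noise i (S ω))

/-- Error assumption E2 for a simulation `S` in a redaction class and a simulation `S'` in a
reduced redaction class of it: no execution of `S'` has a larger variation distance than any
execution of `S`. The simulations may contain randomly chosen gates. If the inequality holds for
all fixed members of the two classes, it holds for all randomly chosen ones. -/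
def E2 {N m : ℕ} (noise : Noise N m) {Ω Ω' : Type} [Fintype Ω] [Fintype Ω']
    (S : Ω → HQS N) (S' : Ω' → HQS N) : Prop :=
  ∀ D D' : RedactedHQS N, (∀ ω, (S ω).redact = D) → (∀ ω, (S' ω).redact = D') →
    D'.IsReduced D → ∀ i i' : Fin m,
      meanVariationDistance noise S' i' ≤ meanVariationDistance noise S i

/-- Error assumption E3: the error depends only on the redaction class of the simulation. -/
def E3 {N m : ℕ} (noise : Noise N m) : Prop :=
  ∀ (i : Fin m) (C C' : HQS N), C.redact = C'.redact → noise i C = noise i C'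

/-! ### Approximate inversion of the time evolution -/

/-- A nontrivial group of Pauli strings (up to phases) in which each non-identity term of the
Hamiltonian anticommutes with at least one element. -/
structure InversionGroup {N : ℕ} (c : PauliString N → ℝ) where
  carrier : AddSubgroup (PauliString N)
  anticommute : ∀ u, u ≠ 0 → c u ≠ 0 →
    ∃ σ ∈ carrier, pauliOp σ * pauliOp u + pauliOp u * pauliOp σ = 0
  one_lt_card : 1 < Nat.card carrier

/-- The number `L` of elements of the group. -/
def InversionGroup.L {N : ℕ} {c : PauliString N → ℝ} (G : InversionGroup c) : ℕ :=
  Nat.card G.carrier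

/-- The non-identity elements of the group. -/
abbrev InversionGroup.NonId {N : ℕ} {c : PauliString N → ℝ} (G : InversionGroup c) : Type :=
  {σ : PauliString N // σ ∈ G.carrier ∧ σ ≠ 0}

instance {N : ℕ} {c : PauliString N → ℝ} (G : InversionGroup c) : Fintype G.NonId :=
  Fintype.ofFinite _

/-- The number `M = ⌈2 t² (∑ᵤ |c u|)² L / (ε (L - 1))⌉` of parts into which an evolution of duration
`t` is split for its approximate inversion. -/
def InversionGroup.M {N : ℕ} {c : PauliString N → ℝ} (G : InversionGroup c) (t ε : ℝ) : ℕ :=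
  ⌈2 * t ^ 2 * (∑ u, |c u|) ^ 2 * (G.L : ℝ) / (ε * ((G.L : ℝ) - 1))⌉₊

/-- `e^{-iHt}` split into `M` equal parts, part `k` being preceded and followed by the layer `g k`. -/
def splitEvolution {N M : ℕ} (t : ℝ) (g : Fin M → Fin N → Option Gate) : List (HQSPart N) :=
  (List.ofFn fun k => [HQSPart.gates (g k), .evolve (t / M), .gates (g k)]).flatten

/-- `t₁' = t / L`. -/
def InversionGroup.t₁ {N : ℕ} {c : PauliString N → ℝ} (G : InversionGroup c) (t : ℝ) : ℝ :=
  t / G.L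

/-- `t₂' = (L - 1) t / L`. -/
def InversionGroup.t₂ {N : ℕ} {c : PauliString N → ℝ} (G : InversionGroup c) (t : ℝ) : ℝ :=
  ((G.L : ℝ) - 1) * t / G.L

/-! ### Target and trap simulations -/

/-- The number of parts into which the second stage of the evolution is split. -/
def numSteps {N : ℕ} (A : AQS N) (ε : ℝ) (G : InversionGroup A.coeff) : ℕ := G.M (G.t₂ A.t) ε

/-- The common form of target and trap simulations: a layer of gates, evolution for `t₁'`,
split evolution for `t₂'` with layers `g k`, a final layer of gates. -/
def blockSimulation {N : ℕ} (A : AQS N) (ε : ℝ) (G : InversionGroup A.coeff)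
    (first last : Fin N → Gate) (g : Fin (numSteps A ε G) → Fin N → Option Gate) : HQS N where
  coeff := A.coeff
  parts := [HQSPart.gates fun j => some (first j), .evolve (G.t₁ A.t)]
    ++ splitEvolution (G.t₂ A.t) g ++ [HQSPart.gates fun j => some (last j)]

/-- The target simulation. -/
def targetSimulation {N : ℕ} (A : AQS N) (ε : ℝ) (G : InversionGroup A.coeff) : HQS N :=
  blockSimulation A ε G A.prep A.meas fun _ _ => none

/-- The random choices in a trap simulation: the bit `h`; for each qubit whether `Z` is applied in
the first layer; for each qubit a Pauli gate; for each qubit whether `Z` is applied in the last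
layer; and for each of the split evolutions a non-identity element of the group.
All of them are uniform and independent. -/
abbrev TrapChoice {N : ℕ} (A : AQS N) (ε : ℝ) (G : InversionGroup A.coeff) : Type :=
  Fin 2 × (Fin N → Fin 2) × (Fin N → Pauli) × (Fin N → Fin 2) ×
    (Fin (numSteps A ε G) → G.NonId)

/-- The trap simulation with given random choices: `Pⱼ Hʰ Zᶻ` on qubit `j` in the first layer, the
chosen Pauli strings around the split evolutions, and `Zᶻ' Hʰ Pⱼ` on qubit `j` in the last layer. -/
def trapSimulation {N : ℕ} (A : AQS N) (ε : ℝ) (G : InversionGroup A.coeff) :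
    TrapChoice A ε G → HQS N
  | (h, z, P, z', σ) =>
    blockSimulation A ε G
      (fun j => pauliGate (P j) * hadamardGate ^ (h : ℕ) * pauliGate (0, 1) ^ (z j : ℕ))
      (fun j => pauliGate (0, 1) ^ (z' j : ℕ) * hadamardGate ^ (h : ℕ) * pauliGate (P j))
      (fun k j => some (pauliGate ((σ k).1 j)))

/-- The probability that an error-free trap simulation gives an outcome other than `0⋯0`. -/
def idealTrapFailure {N : ℕ} (A : AQS N) (ε : ℝ) (G : InversionGroup A.coeff) : ℝ :=
  average fun ω => 1 - (trapSimulation A ε G ω).idealProb 0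

/-- The probability that the trap simulation executed in slot `i` gives an outcome other than
`0⋯0`. -/
def trapFailure {N m : ℕ} (A : AQS N) (ε : ℝ) (G : InversionGroup A.coeff) (noise : Noise N m)
    (i : Fin m) : ℝ :=
  average fun ω => 1 - actualProb (trapSimulation A ε G ω) (noise i (trapSimulation A ε G ω)) 0

/-! ### The accreditation protocol -/

/-- The number of trap simulations. -/
def numTraps (θ α : ℝ) : ℕ := ⌈2 / θ ^ 2 * Real.log (2 / (1 - α))⌉₊ + 1

/-- What happens in a run of the protocol with `m` time slots: the slot of the target simulation,
and for each slot the random choices for a trap (ignored in the slot of the target) and the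
measurement outcome. -/
abbrev Run {N : ℕ} (A : AQS N) (ε : ℝ) (G : InversionGroup A.coeff) (m : ℕ) : Type :=
  Fin m × (Fin m → TrapChoice A ε G × Reg N)

section Run

variable {N m : ℕ} {A : AQS N} {ε : ℝ} {G : InversionGroup A.coeff}

/-- The slot of the target simulation. -/
def Run.targetSlot (r : Run A ε G m) : Fin m := r.1

/-- The simulation executed in slot `i`. -/
def Run.simulation (r : Run A ε G m) (i : Fin m) : HQS N :=
  if i = r.targetSlot then targetSimulation A ε G else trapSimulation A ε G (r.2 i).1

/-- The measurement outcome in slot `i`. -/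
def Run.outcome (r : Run A ε G m) (i : Fin m) : Reg N := (r.2 i).2

/-- The slots in which traps are executed. -/
def Run.trapSlots (r : Run A ε G m) : Finset (Fin m) := Finset.univ.erase r.targetSlot

/-- The slots in which a trap gave an incorrect outcome. -/
def Run.incorrectTraps (r : Run A ε G m) : Finset (Fin m) :=
  r.trapSlots.filter fun i => r.outcome i ≠ 0

/-- The bound returned by the protocol: twice the number of incorrect traps, divided by the total
number of simulations. -/
def Run.epsVD (r : Run A ε G m) : ℝ := 2 * (r.incorrectTraps.card : ℝ) / (m : ℝ)

/-- The probability of a run. The slot of the target and the random choices are uniform and, as the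
errors in different simulations are independent (E1), so are the outcomes in different slots. -/
def Run.weight (noise : Noise N m) (r : Run A ε G m) : ℝ :=
  (1 / (m : ℝ)) * ∏ i, (1 / (Fintype.card (TrapChoice A ε G) : ℝ)
    * actualProb (r.simulation i) (noise i (r.simulation i)) (r.outcome i))

end Run

open Classical in
/-- The probability of an event in a run of the protocol. -/
def runProbability {N m : ℕ} (A : AQS N) (ε : ℝ) (G : InversionGroup A.coeff) (noise : Noise N m)
    (event : Run A ε G m → Prop) : ℝ :=
  ∑ r : Run A ε G m, if event r then r.weight noise else 0

/-- The expectation of the returned bound when the target is in slot `τ`: twice the sum of the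
probabilities that the traps give incorrect outcomes, divided by the number of simulations. -/
def expectedBound {N m : ℕ} (A : AQS N) (ε : ℝ) (G : InversionGroup A.coeff) (noise : Noise N m)
    (τ : Fin m) : ℝ :=
  2 * (∑ i ∈ Finset.univ.erase τ, trapFailure A ε G noise i) / (m : ℝ)

/-- The variation distance of the execution of the target simulation in slot `τ`. -/
def targetDistance {N m : ℕ} (A : AQS N) (ε : ℝ) (G : InversionGroup A.coeff) (noise : Noise N m)
    (τ : Fin m) : ℝ :=
  variationDistance (targetSimulation A ε G) (noise τ (targetSimulation A ε G))

end AnalogueAccreditation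

end

open AnalogueAccreditation

namespace AnalogueAccreditation

/-! ### Tensor products of single-qubit operators -/

/-! Two independent arguments meet in the final bound: error-free traps almost always return `0⋯0`,
and their observed failures control the target.

Inversion. For a non-identity term `P_u` of the Hamiltonian, the sign with which `σ` commutes past
`P_u` is a nontrivial character of the group, so its sum over the non-identity elements is `-1`
(`InversionGroup.sum_stringSign`). Averaging the conjugates of the traceless Hamiltonian `H` over
these elements therefore gives `-H/(L-1)`. A short evolution for `δ`, averaged in the same way,
agrees to first order with an evolution for `-δ/(L-1)`. The choices in the `M` steps are
independent, so the averaged operator is a power of the averaged step; it undoes the first stage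
because `t₂'/(L-1) = t₁'`. The second-order errors add up to at most `ε/2` when `ε < 1`
(`InversionGroup.norm_twirl_pow_sub_le`), and the identity term contributes only a phase. Hence the
mean amplitude of `0⋯0` has modulus at least `1 - ε/2`, and since a mean square dominates the square
of the mean, the mean probability is at least `1 - ε` (`sum_one_sub_idealProb_le`).

Accreditation. The variation distance of two distributions is at most the sum of the masses that
they put off one chosen outcome. Applied to `0⋯0`, this bounds the mean distance of a trap by its
failure probability plus `η`. E2 transfers the bound to the target, because the target is the trap
with the intermediate gates removed. Averaging over all trap slots handles errors that vary from
slot to slot; the factor `2` in the returned bound compensates for dividing by the number of all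
slots instead of the number of traps (`targetDistance_le_expectedBound`). Given the slot of the
target, the outcomes are independent, so Hoeffding's inequality shows that the returned bound is
within `θ` of its mean with probability at least `α` (`le_runProbability`,
`le_one_sub_exp_numTraps`). -/

theorem tensorOp_mul {N : ℕ} (f g : Fin N → Matrix (Fin 2) (Fin 2) ℂ) :
    tensorOp f * tensorOp g = tensorOp fun j => f j * g j := by
  ext s s'
  simp only [tensorOp, Matrix.mul_apply, Matrix.of_apply, ← Finset.prod_mul_distrib]
  rw [Finset.prod_univ_sum, Fintype.piFinset_univ]

theorem tensorOp_one {N : ℕ} : tensorOp (fun _ : Fin N => 1) = 1 := by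
  ext s s'
  simp only [tensorOp, Matrix.of_apply, Matrix.one_apply]
  by_cases h : s = s'
  · simp [h]
  · obtain ⟨j, hj⟩ := Function.ne_iff.mp h
    rw [if_neg h]
    exact Finset.prod_eq_zero (Finset.mem_univ j) (if_neg hj)

theorem tensorOp_smul {N : ℕ} (a : Fin N → ℂ) (f : Fin N → Matrix (Fin 2) (Fin 2) ℂ) :
    tensorOp (fun j => a j • f j) = (∏ j, a j) • tensorOp f := by
  ext s s'
  simp [tensorOp, Finset.prod_mul_distrib]

theorem tensorOp_conjTranspose {N : ℕ} (f : Fin N → Matrix (Fin 2) (Fin 2) ℂ) :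
    (tensorOp f)ᴴ = tensorOp fun j => (f j)ᴴ := by
  ext s s'
  simp [tensorOp, Matrix.conjTranspose_apply]

theorem tensorOp_gate_mem {N : ℕ} (g : Fin N → Gate) :
    tensorOp (fun j => (g j : Matrix (Fin 2) (Fin 2) ℂ)) ∈ Matrix.unitaryGroup (Reg N) ℂ := by
  rw [Matrix.mem_unitaryGroup_iff, Matrix.star_eq_conjTranspose, tensorOp_conjTranspose,
    tensorOp_mul, ← tensorOp_one]
  congr 1
  funext j
  exact Matrix.mem_unitaryGroup_iff.mp (g j).2

/-! ### Pauli strings -/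

theorem pauliMatrix_zero : pauliMatrix 0 = 1 := if_pos rfl

theorem pauliMatrix_conjTranspose (p : Pauli) : (pauliMatrix p)ᴴ = pauliMatrix p := by
  unfold pauliMatrix
  split_ifs <;> ext i j <;> fin_cases i <;> fin_cases j <;>
    simp [Matrix.conjTranspose_apply]

theorem pauliMatrix_mul_self (p : Pauli) : pauliMatrix p * pauliMatrix p = 1 := by
  have h := Matrix.mem_unitaryGroup_iff.mp (pauliMatrix_mem p)
  rwa [Matrix.star_eq_conjTranspose, pauliMatrix_conjTranspose] at h

theorem pauliOp_zero {N : ℕ} : pauliOp (0 : PauliString N) = 1 := by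
  simp [pauliOp, pauliMatrix_zero, tensorOp_one]

theorem pauliOp_mul_self {N : ℕ} (u : PauliString N) : pauliOp u * pauliOp u = 1 := by
  simp [pauliOp, tensorOp_mul, pauliMatrix_mul_self, tensorOp_one]

theorem pauliOp_conjTranspose {N : ℕ} (u : PauliString N) : (pauliOp u)ᴴ = pauliOp u := by
  simp [pauliOp, tensorOp_conjTranspose, pauliMatrix_conjTranspose]

theorem pauliOp_mem {N : ℕ} (u : PauliString N) :
    pauliOp u ∈ Matrix.unitaryGroup (Reg N) ℂ := by
  rw [Matrix.mem_unitaryGroup_iff, Matrix.star_eq_conjTranspose, pauliOp_conjTranspose,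
    pauliOp_mul_self]

theorem pauliOp_ne_zero {N : ℕ} (u : PauliString N) : pauliOp u ≠ 0 := fun h => by
  have := pauliOp_mul_self u
  rw [h, zero_mul] at this
  exact zero_ne_one this

/-- `1` if the Pauli operators with labels `p` and `q` commute, `-1` if they anticommute. -/
def pauliSign (p q : Pauli) : ℤ := if p.1 * q.2 = p.2 * q.1 then 1 else -1

theorem pauliSign_add (p p' q : Pauli) :
    pauliSign (p + p') q = pauliSign p q * pauliSign p' q := by
  revert p p' q
  decide

theorem pauliMatrix_conj (p q : Pauli) :
    pauliMatrix p * pauliMatrix q * pauliMatrix p = (pauliSign p q : ℂ) • pauliMatrix q := by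
  have hp : ∀ p : Pauli, p = (0, 0) ∨ p = (1, 0) ∨ p = (0, 1) ∨ p = (1, 1) := by decide
  rcases hp p with rfl | rfl | rfl | rfl <;> rcases hp q with rfl | rfl | rfl | rfl <;>
    ext i j <;> fin_cases i <;> fin_cases j <;>
    simp [pauliMatrix, pauliSign, Matrix.mul_apply, Fin.sum_univ_two]

/-- `1` if the Pauli strings commute, `-1` if they anticommute. -/
def stringSign {N : ℕ} (σ u : PauliString N) : ℤ := ∏ j, pauliSign (σ j) (u j)

theorem stringSign_add {N : ℕ} (σ σ' u : PauliString N) :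
    stringSign (σ + σ') u = stringSign σ u * stringSign σ' u := by
  simp [stringSign, pauliSign_add, Finset.prod_mul_distrib]

theorem stringSign_zero {N : ℕ} (u : PauliString N) : stringSign 0 u = 1 := by
  simp [stringSign, pauliSign]

theorem pauliOp_conj {N : ℕ} (σ u : PauliString N) :
    pauliOp σ * pauliOp u * pauliOp σ = (stringSign σ u : ℂ) • pauliOp u := by
  simp only [pauliOp, tensorOp_mul, pauliMatrix_conj, tensorOp_smul, stringSign]
  push_cast
  rfl

theorem stringSign_ne_one_of_anticommute {N : ℕ} {σ u : PauliString N}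
    (h : pauliOp σ * pauliOp u + pauliOp u * pauliOp σ = 0) : stringSign σ u ≠ 1 := fun h1 => by
  have h2 := pauliOp_conj σ u
  rw [eq_neg_of_add_eq_zero_left h, neg_mul, mul_assoc, pauliOp_mul_self, mul_one, h1,
    Int.cast_one, one_smul, neg_eq_iff_add_eq_zero, ← two_smul ℂ] at h2
  exact pauliOp_ne_zero u ((smul_eq_zero.mp h2).resolve_left two_ne_zero)

/-- A single-qubit Pauli gate suffices, placed where `u` is not the identity and anticommuting with
`u` there; all other qubits contribute the sign `1`. -/
theorem exists_anticommute {N : ℕ} {u : PauliString N} (hu : u ≠ 0) :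
    ∃ σ : PauliString N, pauliOp σ * pauliOp u + pauliOp u * pauliOp σ = 0 := by
  obtain ⟨j, hj⟩ := Function.ne_iff.mp hu
  have h1 : ∀ q : Pauli, q ≠ 0 → ∃ p, pauliSign p q = -1 := by decide
  obtain ⟨p, hp⟩ := h1 (u j) hj
  refine ⟨Pi.single j p, ?_⟩
  have h2 : stringSign (Pi.single j p) u = -1 := by
    rw [stringSign, Finset.prod_eq_single j]
    · simpa using hp
    · intro b _ hb
      simp [Pi.single_eq_of_ne hb, pauliSign]
    · simp
  have h3 := congrArg (· * pauliOp (Pi.single j p)) (pauliOp_conj (Pi.single j p) u)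
  simp only [mul_assoc, pauliOp_mul_self, mul_one, h2] at h3
  rw [h3]
  simp

theorem nonempty_inversionGroup {N : ℕ} (hN : 0 < N) (c : PauliString N → ℝ) :
    Nonempty (InversionGroup c) := by
  -- The group of all Pauli strings works for every Hamiltonian; it is nontrivial because there is
  -- at least one qubit.
  refine ⟨⟨⊤, fun u hu _ => ?_, ?_⟩⟩
  · obtain ⟨σ, hσ⟩ := exists_anticommute hu
    exact ⟨σ, AddSubgroup.mem_top σ, hσ⟩
  · have : Nonempty (Fin N) := ⟨⟨0, hN⟩⟩
    rw [Finite.one_lt_card_iff_nontrivial]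
    infer_instance

/-! ### Twirling over the group -/

section Twirl

variable {N : ℕ} {c : PauliString N → ℝ} (G : InversionGroup c)

theorem InversionGroup.sum_nonId {M : Type*} [AddCommMonoid M] [Fintype G.carrier]
    (f : PauliString N → M) :
    f 0 + ∑ σ : G.NonId, f σ.1 = ∑ σ : G.carrier, f σ.1 := by
  classical
  rw [← Finset.add_sum_erase Finset.univ _ (Finset.mem_univ (0 : G.carrier))]
  congr 1
  refine Finset.sum_bij' (fun σ _ => ⟨σ.1, σ.2.1⟩) (fun σ hσ => ⟨σ.1, σ.2, fun h =>
    Finset.ne_of_mem_erase hσ (Subtype.ext h)⟩) ?_ ?_ ?_ ?_ ?_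
  · intro σ _
    exact Finset.mem_erase.mpr ⟨fun h => σ.2.2 (congrArg Subtype.val h), Finset.mem_univ _⟩
  all_goals intros; simp

theorem InversionGroup.card_nonId : (Fintype.card G.NonId : ℝ) = (G.L : ℝ) - 1 := by
  classical
  have : Fintype G.carrier := Fintype.ofFinite _
  have h := G.sum_nonId (fun _ => (1 : ℝ))
  simp only [Finset.sum_const, Finset.card_univ, nsmul_eq_mul, mul_one] at h
  rw [InversionGroup.L, Nat.card_eq_fintype_card, ← h]
  ring

theorem InversionGroup.two_le_L : (2 : ℝ) ≤ G.L := by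
  have := G.one_lt_card
  exact_mod_cast this

/-- Character orthogonality: the sign is multiplicative in `σ` and differs from `1` at some `τ` in
the group, so translation by `τ` forces the sum over the whole group to vanish. The identity
accounts for `1` of it. -/
theorem InversionGroup.sum_stringSign {u : PauliString N} (hu : u ≠ 0) (hc : c u ≠ 0) :
    ∑ σ : G.NonId, stringSign σ.1 u = -1 := by
  classical
  have : Fintype G.carrier := Fintype.ofFinite _
  have h := G.sum_nonId (fun σ => stringSign σ u)
  obtain ⟨τ, hτ, hanti⟩ := G.anticommute u hu hc
  have h1 : stringSign τ u * ∑ σ : G.carrier, stringSign σ.1 u =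
      ∑ σ : G.carrier, stringSign σ.1 u := by
    rw [Finset.mul_sum]
    refine Fintype.sum_equiv (Equiv.addLeft (⟨τ, hτ⟩ : G.carrier)) _ _ fun σ => ?_
    simp [stringSign_add]
  have h2 : ∑ σ : G.carrier, stringSign σ.1 u = 0 := by
    by_contra h0
    exact stringSign_ne_one_of_anticommute hanti (mul_right_cancel₀ h0 (by rw [h1, one_mul]))
  rw [h2, stringSign_zero] at h
  linarith

/-- The Pauli coefficients of the Hamiltonian without its identity term. -/
def traceless (c : PauliString N → ℝ) : PauliString N → ℝ := Function.update c 0 0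

/-- The identity term has to be excluded: it commutes with everything, so the sum would multiply it
by `L - 1` instead of `-1`. -/
theorem InversionGroup.sum_conj_hamiltonian :
    ∑ σ : G.NonId, pauliOp σ.1 * hamiltonian (traceless c) * pauliOp σ.1 =
      -hamiltonian (traceless c) := by
  simp only [hamiltonian, Finset.mul_sum, Finset.sum_mul, mul_smul_comm, smul_mul_assoc,
    pauliOp_conj]
  rw [Finset.sum_comm, ← Finset.sum_neg_distrib]
  refine Finset.sum_congr rfl fun u _ => ?_
  rw [← Finset.smul_sum, ← Finset.sum_smul, ← Int.cast_sum]
  by_cases hu : u = 0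
  · simp [hu, traceless]
  by_cases hc : c u = 0
  · simp [traceless, hu, hc]
  rw [G.sum_stringSign hu hc]
  simp

theorem hamiltonian_eq_add (c : PauliString N → ℝ) :
    hamiltonian c = (c 0 : ℂ) • 1 + hamiltonian (traceless c) := by
  classical
  unfold hamiltonian
  rw [← Finset.add_sum_erase _ _ (Finset.mem_univ (0 : PauliString N)), pauliOp_zero,
    ← Finset.add_sum_erase (Finset.univ : Finset (PauliString N)) (fun u => (traceless c u : ℂ) • _)
      (Finset.mem_univ (0 : PauliString N))]
  have h0 : traceless c 0 = 0 := by simp [traceless]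
  rw [h0, Complex.ofReal_zero, zero_smul, zero_add]
  congr 1
  refine Finset.sum_congr rfl fun u hu => ?_
  rw [traceless, Function.update_of_ne (Finset.ne_of_mem_erase hu)]

theorem sum_abs_traceless_le (c : PauliString N → ℝ) : ∑ u, |traceless c u| ≤ ∑ u, |c u| := by
  refine Finset.sum_le_sum fun u _ => ?_
  by_cases hu : u = 0
  · simp [hu, traceless]
  · simp [traceless, hu]

end Twirl

/-! ### Norm estimates -/

section Norm

/-- From the quadratic term on, the exponential series is dominated term by term by that of the real
number `‖x‖`, which reduces the claim to the scalar estimate. -/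
theorem norm_exp_sub_one_sub_le_sq {𝔸 : Type*} [NormedRing 𝔸] [NormedAlgebra ℂ 𝔸] [CompleteSpace 𝔸]
    {x : 𝔸} (hx : ‖x‖ ≤ 1) : ‖NormedSpace.exp x - 1 - x‖ ≤ ‖x‖ ^ 2 := by
  have h1 := (hasSum_nat_add_iff' 2).mpr (NormedSpace.exp_series_hasSum_exp' (𝕂 := ℂ) x)
  have h2 := (hasSum_nat_add_iff' 2).mpr (NormedSpace.exp_series_hasSum_exp' (𝕂 := ℝ) ‖x‖)
  simp only [Finset.sum_range_succ, Finset.sum_range_zero, Nat.factorial, Nat.cast_one, inv_one,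
    pow_zero, pow_one, one_smul, zero_add, ← sub_sub, mul_one] at h1 h2
  have h3 := h1.norm_le_of_bounded h2 fun n => ?_
  · rw [← Real.exp_eq_exp_ℝ] at h3
    refine h3.trans ((le_abs_self _).trans ?_)
    exact Real.abs_exp_sub_one_sub_id_le (by rwa [abs_norm])
  · rw [norm_smul, smul_eq_mul]
    refine mul_le_mul (le_of_eq ?_) (norm_pow_le' _ (by omega)) (norm_nonneg _) (by positivity)
    rw [norm_inv, Complex.norm_natCast]

/-- Telescoping: replacing one factor at a time costs `‖a - b‖`, as the other factors are
contractions. -/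
theorem norm_pow_sub_pow_le {𝔸 : Type*} [NormedRing 𝔸] [NormOneClass 𝔸] {a b : 𝔸}
    (ha : ‖a‖ ≤ 1) (hb : ‖b‖ ≤ 1) (n : ℕ) : ‖a ^ n - b ^ n‖ ≤ n * ‖a - b‖ := by
  induction n with
  | zero => simp
  | succ n ih =>
    have h : a ^ (n + 1) - b ^ (n + 1) = a ^ n * (a - b) + (a ^ n - b ^ n) * b := by
      rw [pow_succ, pow_succ]
      noncomm_ring
    have han : ‖a ^ n‖ ≤ 1 := (norm_pow_le a n).trans (pow_le_one₀ (norm_nonneg _) ha)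
    calc ‖a ^ (n + 1) - b ^ (n + 1)‖ ≤ ‖a ^ n‖ * ‖a - b‖ + ‖a ^ n - b ^ n‖ * ‖b‖ := by
          rw [h]
          exact (norm_add_le _ _).trans (add_le_add (norm_mul_le _ _) (norm_mul_le _ _))
      _ ≤ 1 * ‖a - b‖ + (n * ‖a - b‖) * 1 := by gcongr
      _ = ((n + 1 : ℕ) : ℝ) * ‖a - b‖ := by push_cast; ring

open scoped Matrix.Norms.L2Operator

theorem norm_unitary_le_one {n : Type*} [Fintype n] [DecidableEq n] {U : Matrix n n ℂ}
    (hU : U ∈ Matrix.unitaryGroup n ℂ) : ‖U‖ ≤ 1 := by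
  cases isEmpty_or_nonempty n
  · rw [Subsingleton.elim U 0, norm_zero]
    exact zero_le_one
  · exact (CStarRing.norm_of_mem_unitary hU).le

theorem norm_entry_le_l2_opNorm {n : Type*} [Fintype n] [DecidableEq n] (X : Matrix n n ℂ)
    (i j : n) : ‖X i j‖ ≤ ‖X‖ := by
  have h := Matrix.l2_opNorm_mulVec X (EuclideanSpace.single j (1 : ℂ))
  rw [PiLp.norm_single, norm_one, mul_one] at h
  refine le_trans ?_ h
  refine le_trans (le_of_eq ?_) (PiLp.norm_apply_le _ i)
  simp

end Norm

/-! ### Time evolution -/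

section Evolution

variable {N : ℕ} (c : PauliString N → ℝ)

theorem hamiltonian_conjTranspose : (hamiltonian c)ᴴ = hamiltonian c := by
  simp [hamiltonian, Matrix.conjTranspose_sum, pauliOp_conjTranspose]

theorem evolution_add (a b : ℝ) : evolution c (a + b) = evolution c a * evolution c b := by
  rw [evolution, evolution, evolution, ← Matrix.exp_add_of_commute]
  · congr 1
    rw [← add_smul]
    push_cast
    ring_nf
  · exact ((Commute.refl _).smul_left _).smul_right _

theorem evolution_eq_one {τ : ℝ} (h : (τ : ℂ) • hamiltonian c = 0) : evolution c τ = 1 := by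
  rw [evolution, ← neg_mul, ← smul_smul, h, smul_zero, NormedSpace.exp_zero]

theorem evolution_zero : evolution c 0 = 1 := evolution_eq_one c (by simp)

theorem evolution_nsmul (n : ℕ) (τ : ℝ) : evolution c (n * τ) = evolution c τ ^ n := by
  induction n with
  | zero => simp [evolution_zero]
  | succ n ih => rw [Nat.cast_succ, add_mul, one_mul, evolution_add, ih, pow_succ]

theorem evolution_conjTranspose (τ : ℝ) : (evolution c τ)ᴴ = evolution c (-τ) := by
  rw [evolution, evolution, ← Matrix.exp_conjTranspose, Matrix.conjTranspose_smul,
    hamiltonian_conjTranspose]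
  simp

theorem evolution_mem (τ : ℝ) : evolution c τ ∈ Matrix.unitaryGroup (Reg N) ℂ := by
  rw [Matrix.mem_unitaryGroup_iff, Matrix.star_eq_conjTranspose, evolution_conjTranspose,
    ← evolution_add, add_neg_cancel, evolution_zero]

/-- The identity term of the Hamiltonian contributes a global phase. -/
theorem evolution_eq_smul (τ : ℝ) :
    evolution c τ = Complex.exp ((-(c 0 * τ) : ℝ) * Complex.I) • evolution (traceless c) τ := by
  have h : (-(Complex.I * (τ : ℂ))) • hamiltonian c =
      Matrix.diagonal (fun _ : Reg N => ((-(c 0 * τ) : ℝ) : ℂ) * Complex.I) +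
        (-(Complex.I * (τ : ℂ))) • hamiltonian (traceless c) := by
    rw [hamiltonian_eq_add c, smul_add, ← Matrix.smul_one_eq_diagonal, smul_smul]
    congr 2
    push_cast
    ring
  rw [evolution, h, Matrix.exp_add_of_commute, Matrix.exp_diagonal, evolution]
  · have h2 : (NormedSpace.exp fun _ : Reg N => ((-(c 0 * τ) : ℝ) : ℂ) * Complex.I) =
        fun _ => Complex.exp (((-(c 0 * τ) : ℝ) : ℂ) * Complex.I) := by
      funext s
      rw [Pi.coe_exp, Complex.exp_eq_exp_ℂ]
    rw [h2, ← Matrix.smul_one_eq_diagonal, smul_mul_assoc, one_mul]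
  · rw [← Matrix.smul_one_eq_diagonal]
    exact (Commute.one_left _).smul_left _

theorem norm_phase (x : ℝ) : ‖Complex.exp ((x : ℂ) * Complex.I)‖ = 1 :=
  Complex.norm_exp_ofReal_mul_I x

end Evolution

/-! ### Parts of a simulation -/

section Parts

variable {N : ℕ} (c : PauliString N → ℝ)

theorem partsOp_append (l l' : List (HQSPart N)) :
    partsOp c (l ++ l') = partsOp c l' * partsOp c l := by
  induction l with
  | nil => simp [partsOp]
  | cons p l ih => simp [partsOp, ih, mul_assoc]

theorem optGate_layer_mem (g : Fin N → Option Gate) :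
    tensorOp (fun j => optGate (g j)) ∈ Matrix.unitaryGroup (Reg N) ℂ := by
  have h : (fun j => optGate (g j)) =
      fun j => (((g j).getD 1 : Gate) : Matrix (Fin 2) (Fin 2) ℂ) := by
    funext j
    cases g j <;> simp [optGate]
  rw [h]
  exact tensorOp_gate_mem _

theorem HQSPart.op_mem (p : HQSPart N) : p.op c ∈ Matrix.unitaryGroup (Reg N) ℂ := by
  cases p with
  | evolve τ => exact evolution_mem c τ
  | gates g => exact optGate_layer_mem g

theorem partsOp_mem (l : List (HQSPart N)) : partsOp c l ∈ Matrix.unitaryGroup (Reg N) ℂ := by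
  induction l with
  | nil => exact one_mem _
  | cons p l ih => exact mul_mem ih (p.op_mem c)

/-- Evolution for `τ` between two layers of gates `g`. -/
noncomputable def conjStep (τ : ℝ) (g : Fin N → Option Gate) : Op N :=
  tensorOp (fun j => optGate (g j)) * evolution c τ * tensorOp (fun j => optGate (g j))

theorem partsOp_split_succ {n : ℕ} (τ : ℝ) (g : Fin (n + 1) → Fin N → Option Gate) :
    partsOp c (List.ofFn fun k => [HQSPart.gates (g k), .evolve τ, .gates (g k)]).flatten =
      partsOp c (List.ofFn fun k : Fin n =>
        [HQSPart.gates (g k.succ), .evolve τ, .gates (g k.succ)]).flatten *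
          conjStep c τ (g 0) := by
  rw [List.ofFn_succ, List.flatten_cons, partsOp_append]
  simp [partsOp, HQSPart.op, conjStep, mul_assoc]

/-- Distributivity, the operator form of independence: the choices in different steps do not
interact, so the sum over all sequences is a power of the sum for one step. -/
theorem sum_partsOp_split {ι : Type*} [Fintype ι] (τ : ℝ) (f : ι → Fin N → Option Gate) (n : ℕ) :
    ∑ σ : Fin n → ι, partsOp c (List.ofFn fun k =>
      [HQSPart.gates (f (σ k)), .evolve τ, .gates (f (σ k))]).flatten =
        (∑ i, conjStep c τ (f i)) ^ n := by
  induction n with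
  | zero => simp [partsOp]
  | succ n ih =>
    rw [← (Fin.consEquiv fun _ => ι).sum_comp, Fintype.sum_prod_type_right, pow_succ, ← ih,
      Finset.sum_mul]
    refine Finset.sum_congr rfl fun σ _ => ?_
    rw [Finset.mul_sum]
    refine Finset.sum_congr rfl fun i _ => ?_
    rw [partsOp_split_succ]
    simp [Fin.consEquiv]

theorem partsOp_split_none (τ : ℝ) (n : ℕ) :
    partsOp c (List.ofFn fun _ : Fin n =>
      [HQSPart.gates fun _ => none, .evolve τ, .gates fun _ => none]).flatten =
        evolution c τ ^ n := by
  induction n with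
  | zero => simp [partsOp]
  | succ n ih =>
    rw [partsOp_split_succ, ih, conjStep, pow_succ]
    simp [optGate, tensorOp_one]

end Parts

/-! ### Common form of target and trap, and correctness of the target -/

section Block

variable {N : ℕ} (A : AQS N) (ε : ℝ) (G : InversionGroup A.coeff)

theorem partsOp_blockSimulation (first last : Fin N → Gate)
    (g : Fin (numSteps A ε G) → Fin N → Option Gate) :
    partsOp A.coeff (blockSimulation A ε G first last g).parts =
      tensorOp (fun j => (last j : Matrix (Fin 2) (Fin 2) ℂ)) *
        (partsOp A.coeff (splitEvolution (G.t₂ A.t) g) * evolution A.coeff (G.t₁ A.t)) *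
          tensorOp (fun j => (first j : Matrix (Fin 2) (Fin 2) ℂ)) := by
  simp [blockSimulation, partsOp, partsOp_append, HQSPart.op, optGate, mul_assoc]

theorem InversionGroup.t₁_add_t₂ {c : PauliString N → ℝ} (G : InversionGroup c) (t : ℝ) :
    G.t₂ t + G.t₁ t = t := by
  have := G.two_le_L
  rw [InversionGroup.t₂, InversionGroup.t₁]
  field_simp
  ring

theorem InversionGroup.sq_mul_sq_le {c : PauliString N → ℝ} (G : InversionGroup c) {ε : ℝ}
    (hε : 0 < ε) (t : ℝ) : 2 * t ^ 2 * (∑ u, |c u|) ^ 2 * G.L ≤ G.M t ε * (ε * (G.L - 1)) := by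
  have hL := G.two_le_L
  rw [← div_le_iff₀ (mul_pos hε (by linarith))]
  exact Nat.le_ceil _

/-- Splitting an evolution into `M` parts is consistent, also when `M = 0`. -/
theorem InversionGroup.split_eq_or {c : PauliString N → ℝ} (G : InversionGroup c) {ε : ℝ}
    (hε : 0 < ε) (t : ℝ) : (G.M t ε : ℝ) * (t / G.M t ε) = t ∨ c = 0 := by
  by_cases hM : G.M t ε = 0
  · have h := G.sq_mul_sq_le hε t
    rw [hM, Nat.cast_zero, zero_mul] at h
    have hL := G.two_le_L
    have h0 : 0 ≤ t ^ 2 * (∑ u, |c u|) ^ 2 := by positivity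
    -- `M = 0` makes the quantity under the ceiling nonpositive, so either the duration or every
    -- coefficient is zero. In the first case the default value of division by zero is harmless, in
    -- the second all evolutions are trivial.
    have h1 : t ^ 2 * (∑ u, |c u|) ^ 2 = 0 := by nlinarith
    rcases mul_eq_zero.mp h1 with h2 | h2
    · left
      rw [pow_eq_zero_iff two_ne_zero |>.mp h2, zero_div, mul_zero]
    · right
      have h3 := (Finset.sum_eq_zero_iff_of_nonneg fun u _ => abs_nonneg (c u)).mp
        (pow_eq_zero_iff two_ne_zero |>.mp h2)
      exact funext fun u => abs_eq_zero.mp (h3 u (Finset.mem_univ u))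
  · exact Or.inl (mul_div_cancel₀ _ (Nat.cast_ne_zero.mpr hM))

theorem hamiltonian_eq_zero {c : PauliString N → ℝ} (h : c = 0) : hamiltonian c = 0 := by
  simp [hamiltonian, h]

theorem targetSimulation_idealProb (hε : 0 < ε) (s : Reg N) :
    (targetSimulation A ε G).idealProb s = A.prob s := by
  have h : partsOp A.coeff (splitEvolution (G.t₂ A.t)
      fun (_ : Fin (numSteps A ε G)) (_ : Fin N) => none) = evolution A.coeff (G.t₂ A.t) := by
    rw [splitEvolution, partsOp_split_none, ← evolution_nsmul]
    rcases G.split_eq_or hε (G.t₂ A.t) with h | h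
    · exact congrArg _ h
    · rw [evolution_eq_one, evolution_eq_one] <;> rw [hamiltonian_eq_zero h, smul_zero]
  have h2 := partsOp_blockSimulation A ε G A.prep A.meas fun _ _ => none
  rw [h, ← evolution_add, G.t₁_add_t₂] at h2
  rw [HQS.idealProb, AQS.prob, ← h2]
  rfl

end Block

/-! ### Approximate inversion -/

section Inversion

open scoped Matrix.Norms.L2Operator

variable {N : ℕ} {c : PauliString N → ℝ} (G : InversionGroup c)

theorem norm_hamiltonian_le (c : PauliString N → ℝ) : ‖hamiltonian c‖ ≤ ∑ u, |c u| := by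
  refine (norm_sum_le _ _).trans (Finset.sum_le_sum fun u _ => ?_)
  rw [norm_smul, Complex.norm_real, Real.norm_eq_abs]
  exact mul_le_of_le_one_right (abs_nonneg _) (norm_unitary_le_one (pauliOp_mem u))

theorem norm_conj_le {n : Type*} [Fintype n] [DecidableEq n] {U V : Matrix n n ℂ}
    (hU : U ∈ Matrix.unitaryGroup n ℂ) (hV : V ∈ Matrix.unitaryGroup n ℂ) (X : Matrix n n ℂ) :
    ‖U * X * V‖ ≤ ‖X‖ := by
  calc ‖U * X * V‖ ≤ ‖U‖ * ‖X‖ * ‖V‖ :=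
        (norm_mul_le _ _).trans (mul_le_mul_of_nonneg_right (norm_mul_le _ _) (norm_nonneg _))
    _ ≤ 1 * ‖X‖ * 1 := by
        gcongr
        exacts [norm_unitary_le_one hU, norm_unitary_le_one hV]
    _ = ‖X‖ := by ring

/-- The average of an operator conjugated with the non-identity elements of the group. -/
noncomputable def InversionGroup.twirl (X : Op N) : Op N :=
  (((G.L : ℝ) - 1 : ℝ) : ℂ)⁻¹ • ∑ σ : G.NonId, pauliOp σ.1 * X * pauliOp σ.1

theorem InversionGroup.norm_twirl_le (X : Op N) : ‖G.twirl X‖ ≤ ‖X‖ := by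
  have hL := G.two_le_L
  rw [InversionGroup.twirl, norm_smul, norm_inv, Complex.norm_real, Real.norm_eq_abs,
    abs_of_pos (by linarith), inv_mul_le_iff₀ (by linarith), ← G.card_nonId]
  refine (norm_sum_le _ _).trans ((Finset.sum_le_card_nsmul _ _ ‖X‖ fun σ _ =>
    norm_conj_le (pauliOp_mem _) (pauliOp_mem _) X).trans_eq ?_)
  rw [nsmul_eq_mul, Finset.card_univ]

theorem InversionGroup.twirl_add (X Y : Op N) : G.twirl (X + Y) = G.twirl X + G.twirl Y := by
  simp [InversionGroup.twirl, mul_add, add_mul, Finset.sum_add_distrib]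

theorem InversionGroup.twirl_smul (a : ℂ) (X : Op N) : G.twirl (a • X) = a • G.twirl X := by
  simp only [InversionGroup.twirl, mul_smul_comm, smul_mul_assoc, ← Finset.smul_sum]
  rw [smul_comm]

theorem InversionGroup.twirl_one : G.twirl 1 = 1 := by
  have hL := G.two_le_L
  have h : (((G.L : ℝ) - 1 : ℝ) : ℂ) ≠ 0 := by
    rw [Complex.ofReal_ne_zero]
    linarith
  simp only [InversionGroup.twirl, mul_one, pauliOp_mul_self, Finset.sum_const, Finset.card_univ]
  rw [← Nat.cast_smul_eq_nsmul ℂ, smul_smul, ← Complex.ofReal_natCast, G.card_nonId,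
    inv_mul_cancel₀ h, one_smul]

theorem InversionGroup.twirl_hamiltonian :
    G.twirl (hamiltonian (traceless c)) =
      -((((G.L : ℝ) - 1 : ℝ) : ℂ)⁻¹ • hamiltonian (traceless c)) := by
  rw [InversionGroup.twirl, G.sum_conj_hamiltonian, smul_neg]

/-- With `X` and `Y` the two exponents, the twirl fixes `1` and sends `X` to `Y`, so the terms of
order zero and one cancel exactly. Two quadratic remainders are left, and the twirl is a
contraction. -/
theorem InversionGroup.norm_twirl_evolution_sub_le {δ : ℝ} (hδ : |δ| * ∑ u, |c u| ≤ 1) :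
    ‖G.twirl (evolution (traceless c) δ) - evolution (traceless c) (-(δ / (G.L - 1)))‖ ≤
      (|δ| * ∑ u, |c u|) ^ 2 * (1 + 1 / (G.L - 1) ^ 2) := by
  have hL := G.two_le_L
  have hn : (0 : ℝ) < (G.L : ℝ) - 1 := by linarith
  set H := hamiltonian (traceless c) with hH
  set X : Op N := (-(Complex.I * (δ : ℂ))) • H with hX
  set Y : Op N := (-(Complex.I * ((-(δ / (G.L - 1)) : ℝ) : ℂ))) • H with hY
  have hHn : ‖H‖ ≤ ∑ u, |c u| := (norm_hamiltonian_le _).trans (sum_abs_traceless_le c)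
  have hXn : ‖X‖ ≤ |δ| * ∑ u, |c u| := by
    rw [hX, norm_smul]
    simp only [norm_neg, norm_mul, Complex.norm_I, one_mul, Complex.norm_real, Real.norm_eq_abs]
    gcongr
  have hYX : Y = -((((G.L : ℝ) - 1 : ℝ) : ℂ)⁻¹ • X) := by
    rw [hX, hY, smul_smul, ← neg_smul]
    congr 1
    push_cast
    ring
  have hYn : ‖Y‖ = ‖X‖ / (G.L - 1) := by
    rw [hYX, norm_neg, norm_smul, norm_inv, Complex.norm_real, Real.norm_eq_abs, abs_of_pos hn]
    ring
  have hY1 : ‖Y‖ ≤ ‖X‖ := by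
    rw [hYn]
    exact div_le_self (norm_nonneg _) (by linarith)
  have hTX : G.twirl X = Y := by
    rw [hYX, hX, G.twirl_smul, G.twirl_hamiltonian, smul_neg, smul_comm]
  have hdec : G.twirl (NormedSpace.exp X) - NormedSpace.exp Y =
      G.twirl (NormedSpace.exp X - 1 - X) - (NormedSpace.exp Y - 1 - Y) := by
    have h : NormedSpace.exp X = (NormedSpace.exp X - 1 - X) + (1 + X) := by abel
    conv_lhs => rw [h]
    rw [G.twirl_add, G.twirl_add, G.twirl_one, hTX]
    abel
  have e1 := norm_exp_sub_one_sub_le_sq (hXn.trans hδ)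
  have e2 := norm_exp_sub_one_sub_le_sq ((hY1.trans hXn).trans hδ)
  change ‖G.twirl (NormedSpace.exp X) - NormedSpace.exp Y‖ ≤ _
  rw [hdec]
  calc _ ≤ ‖X‖ ^ 2 + ‖Y‖ ^ 2 :=
        (norm_sub_le _ _).trans (add_le_add ((G.norm_twirl_le _).trans e1) e2)
    _ = ‖X‖ ^ 2 * (1 + 1 / (G.L - 1) ^ 2) := by
        rw [hYn, div_pow]
        ring
    _ ≤ _ := by gcongr

/-- The averaged randomised steps invert the first stage of the evolution, up to a phase. -/
theorem InversionGroup.norm_twirl_pow_sub_le {ε : ℝ} (hε : 0 < ε) (hε1 : ε < 1) (t : ℝ) :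
    ∃ p : ℂ, ‖p‖ = 1 ∧
      ‖G.twirl (evolution c (G.t₂ t / G.M (G.t₂ t) ε)) ^ G.M (G.t₂ t) ε * evolution c (G.t₁ t) -
        p • (1 : Op N)‖ ≤ ε / 2 := by
  have hL := G.two_le_L
  have hn : (0 : ℝ) < (G.L : ℝ) - 1 := by linarith
  set M := G.M (G.t₂ t) ε with hM
  set δ : ℝ := G.t₂ t / M with hδ
  set S := ∑ u, |c u| with hS
  have hS0 : 0 ≤ S := Finset.sum_nonneg fun u _ => abs_nonneg _
  -- The choice of `M` in terms of the step length: substitute `t₂' = M * δ` in the bound from the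
  -- ceiling and cancel one factor `M`.
  have hMS : M * (|δ| * S) ^ 2 * (2 * G.L) ≤ ε * (G.L - 1) := by
    rcases Nat.eq_zero_or_pos M with h0 | h0
    · rw [h0, Nat.cast_zero, zero_mul, zero_mul]
      positivity
    · have hM0 : (0 : ℝ) < M := by exact_mod_cast h0
      have h1 : 2 * G.t₂ t ^ 2 * S ^ 2 * G.L ≤ M * (ε * (G.L - 1)) := G.sq_mul_sq_le hε _
      have h2 : G.t₂ t = M * δ := (mul_div_cancel₀ _ hM0.ne').symm
      rw [h2] at h1
      refine le_of_mul_le_mul_left ?_ hM0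
      rw [mul_pow, sq_abs]
      linarith
  have hδS : |δ| * S ≤ 1 := by
    rcases Nat.eq_zero_or_pos M with h0 | h0
    · rw [hδ, h0]
      simp
    · have hM1 : (1 : ℝ) ≤ M := by exact_mod_cast h0
      have h1 : (|δ| * S) ^ 2 ≤ M * (|δ| * S) ^ 2 := le_mul_of_one_le_left (sq_nonneg _) hM1
      refine (sq_le_one_iff₀ (by positivity)).mp ?_
      nlinarith [sq_nonneg (|δ| * S)]
  set c' := traceless c
  set V := evolution c' (-(δ / (G.L - 1)))
  -- The `M` effective backward steps have total duration `t₂'/(L-1) = t₁'`.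
  have hV : V ^ M * evolution c' (G.t₁ t) = 1 := by
    rw [← evolution_nsmul, ← evolution_add]
    rcases G.split_eq_or hε (G.t₂ t) with h | h
    · have h2 : (M : ℝ) * -(δ / (G.L - 1)) + G.t₁ t = 0 := by
        have h3 : (M : ℝ) * δ = G.t₂ t := h
        rw [mul_neg, ← mul_div_assoc, h3, InversionGroup.t₂, InversionGroup.t₁]
        field_simp
        ring
      rw [h2, evolution_zero]
    · have h2 : c' = 0 := by
        change Function.update c 0 0 = 0
        rw [h]
        exact Function.update_eq_self (0 : PauliString N) (0 : PauliString N → ℝ)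
      exact evolution_eq_one _ (by rw [hamiltonian_eq_zero h2, smul_zero])
  -- Conjugation cannot invert the identity term; its phases from the `M` steps and from the first
  -- stage accumulate in `p`.
  refine ⟨Complex.exp ((-(c 0 * δ) : ℝ) * Complex.I) ^ M *
    Complex.exp ((-(c 0 * G.t₁ t) : ℝ) * Complex.I), ?_, ?_⟩
  · rw [norm_mul, norm_pow, norm_phase, norm_phase, one_pow, one_mul]
  · rw [evolution_eq_smul c δ, evolution_eq_smul c (G.t₁ t), G.twirl_smul, smul_pow,
      smul_mul_smul_comm, ← smul_sub, norm_smul, norm_mul, norm_pow, norm_phase, norm_phase,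
      one_pow, one_mul, one_mul, ← hV, ← sub_mul]
    have h1 : ‖G.twirl (evolution c' δ)‖ ≤ 1 :=
      (G.norm_twirl_le _).trans (norm_unitary_le_one (evolution_mem _ _))
    have h2 : ‖V‖ ≤ 1 := norm_unitary_le_one (evolution_mem _ _)
    calc _ ≤ ‖G.twirl (evolution c' δ) ^ M - V ^ M‖ * 1 :=
          (norm_mul_le _ _).trans (by
            gcongr
            exact norm_unitary_le_one (evolution_mem _ _))
      _ ≤ M * ((|δ| * S) ^ 2 * (1 + 1 / (G.L - 1) ^ 2)) := by
          rw [mul_one]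
          refine (norm_pow_sub_pow_le h1 h2 M).trans ?_
          gcongr
          exact G.norm_twirl_evolution_sub_le hδS
      _ ≤ ε / 2 := by
          -- This uses `L - 1 ≥ 1` and explains the factor `L/(L-1)` in `M`: it absorbs the
          -- remainders of both the forward and the backward exponential.
          have h3 : (1 : ℝ) + 1 / (G.L - 1) ^ 2 ≤ G.L / (G.L - 1) := by
            have h4 : (G.L : ℝ) / (G.L - 1) = 1 + 1 / (G.L - 1) := by
              field_simp
              ring
            rw [h4]
            gcongr
            exact le_self_pow₀ (by linarith) two_ne_zero
          have h4 : M * (|δ| * S) ^ 2 ≤ ε * (G.L - 1) / (2 * G.L) := by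
            rwa [le_div_iff₀ (by linarith)]
          calc _ = M * (|δ| * S) ^ 2 * (1 + 1 / (G.L - 1) ^ 2) := by ring
            _ ≤ ε * (G.L - 1) / (2 * G.L) * (G.L / (G.L - 1)) := by
                gcongr
            _ = ε / 2 := by
                field_simp

end Inversion

/-! ### Error-free traps -/

section IdealTrap

open scoped Matrix.Norms.L2Operator

variable {N : ℕ} (A : AQS N) (ε : ℝ) (G : InversionGroup A.coeff)

theorem conjStep_pauli (c : PauliString N → ℝ) (τ : ℝ) (σ : PauliString N) :
    conjStep c τ (fun j => some (pauliGate (σ j))) =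
      pauliOp σ * evolution c τ * pauliOp σ := rfl

theorem one_sub_two_mul_le_norm_sq {z w : ℂ} {η : ℝ} (hw : ‖w‖ = 1) (h : ‖z - w‖ ≤ η) :
    1 - 2 * η ≤ ‖z‖ ^ 2 := by
  have h1 : ‖w‖ - ‖z‖ ≤ ‖z - w‖ := by
    rw [norm_sub_rev]
    exact norm_sub_norm_le w z
  -- The tangent bound `‖z‖² ≥ 2‖z‖ - 1` avoids any case distinction on the sign of `1 - η`.
  nlinarith [sq_nonneg (1 - ‖z‖)]

/-- Only the randomness of the group elements is needed, with the outer layers fixed. Without the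
evolution the layers give `0⋯0` amplitude `1`, so the mean amplitude `b` is close to the phase `p`;
Cauchy–Schwarz passes from mean amplitude to mean probability. -/
theorem sum_one_sub_idealProb_le (hε : 0 < ε) (first last : Fin N → Gate)
    (h : tensorOp (fun j => ((last j * first j : Gate) : Matrix (Fin 2) (Fin 2) ℂ)) 0 0 = 1) :
    ∑ σ : Fin (numSteps A ε G) → G.NonId,
      (1 - (blockSimulation A ε G first last
        fun k j => some (pauliGate ((σ k).1 j))).idealProb 0) ≤
      Fintype.card (Fin (numSteps A ε G) → G.NonId) * ε := by
  classical
  set M := numSteps A ε G with hM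
  set C := fun σ : Fin M → G.NonId =>
    blockSimulation A ε G first last fun k j => some (pauliGate ((σ k).1 j)) with hC
  -- For `ε ≥ 1` the bound is trivial; `ε < 1` is what makes each step short enough for the
  -- exponential estimate.
  rcases le_or_gt 1 ε with hε1 | hε1
  · refine (Finset.sum_le_card_nsmul _ _ ε fun σ _ => ?_).trans_eq ?_
    · have : 0 ≤ (C σ).idealProb 0 := sq_nonneg _
      change 1 - (C σ).idealProb 0 ≤ ε
      linarith
    · rw [nsmul_eq_mul, Finset.card_univ]
  have hL := G.two_le_L
  have hn : (0 : ℝ) < (G.L : ℝ) - 1 := by linarith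
  set F : Op N := tensorOp (fun j => (first j : Matrix (Fin 2) (Fin 2) ℂ))
  set L : Op N := tensorOp (fun j => (last j : Matrix (Fin 2) (Fin 2) ℂ))
  set δ := G.t₂ A.t / M with hδ
  obtain ⟨p, hp, hb⟩ := G.norm_twirl_pow_sub_le hε hε1 A.t
  change ‖G.twirl (evolution A.coeff δ) ^ M * evolution A.coeff (G.t₁ A.t) - p • 1‖ ≤ _ at hb
  set a : (Fin M → G.NonId) → ℂ := fun σ => partsOp A.coeff (C σ).parts 0 0 with ha
  set K : ℝ := (Fintype.card (Fin M → G.NonId) : ℝ) with hK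
  have hKn : K = ((G.L : ℝ) - 1) ^ M := by
    rw [hK, ← G.card_nonId]
    simp
  have hK0 : 0 < K := by
    rw [hKn]
    positivity
  have hsum : ∑ σ, a σ = (K : ℂ) *
      (L * (G.twirl (evolution A.coeff δ) ^ M * evolution A.coeff (G.t₁ A.t)) * F) 0 0 := by
    have h1 : ∑ σ, partsOp A.coeff (C σ).parts = (K : ℂ) •
        (L * (G.twirl (evolution A.coeff δ) ^ M * evolution A.coeff (G.t₁ A.t)) * F) := by
      simp only [hC, partsOp_blockSimulation]
      rw [← Finset.sum_mul, ← Finset.mul_sum, ← Finset.sum_mul]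
      simp only [splitEvolution]
      rw [sum_partsOp_split A.coeff (G.t₂ A.t / (numSteps A ε G : ℝ))
        (fun (σ : G.NonId) j => some (pauliGate (σ.1 j))) (numSteps A ε G)]
      simp only [conjStep_pauli]
      rw [InversionGroup.twirl, smul_pow, smul_mul_assoc, mul_smul_comm, smul_mul_assoc, smul_smul,
        hKn, Complex.ofReal_pow, ← mul_pow, mul_inv_cancel₀ (Complex.ofReal_ne_zero.mpr hn.ne'),
        one_pow, one_smul]
    have h2 := congrFun (congrFun h1 0) 0
    rwa [Matrix.sum_apply, Matrix.smul_apply, smul_eq_mul] at h2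
  set b := (L * (G.twirl (evolution A.coeff δ) ^ M * evolution A.coeff (G.t₁ A.t)) * F) 0 0
  -- Replacing the inverted evolution by `p • 1` leaves the amplitude `p`; an entry of the
  -- difference is at most its operator norm.
  have hbp : ‖b - p‖ ≤ ε / 2 := by
    have h1 : p = (L * (p • (1 : Op N)) * F) 0 0 := by
      rw [mul_smul_comm, smul_mul_assoc, mul_one, tensorOp_mul, Matrix.smul_apply]
      change p = p • tensorOp (fun j => ((last j * first j : Gate) : Matrix (Fin 2) (Fin 2) ℂ)) 0 0
      rw [h, smul_eq_mul, mul_one]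
    rw [h1, ← Matrix.sub_apply, ← sub_mul, ← mul_sub]
    exact (norm_entry_le_l2_opNorm _ 0 0).trans
      ((norm_conj_le (tensorOp_gate_mem _) (tensorOp_gate_mem _) _).trans hb)
  have hb2 := one_sub_two_mul_le_norm_sq hp hbp
  have hCS : (K * ‖b‖) ^ 2 ≤ K * ∑ σ, ‖a σ‖ ^ 2 := by
    have h1 : K * ‖b‖ = ‖∑ σ, a σ‖ := by
      rw [hsum, norm_mul, Complex.norm_real, Real.norm_eq_abs, abs_of_pos hK0]
    rw [h1]
    refine (pow_le_pow_left₀ (norm_nonneg _) (norm_sum_le _ _) 2).trans ?_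
    exact sq_sum_le_card_mul_sum_sq
  have hlow : K * (1 - ε) ≤ ∑ σ, ‖a σ‖ ^ 2 := by
    refine le_of_mul_le_mul_left (le_trans ?_ hCS) hK0
    rw [mul_pow, sq, mul_assoc]
    refine mul_le_mul_of_nonneg_left (mul_le_mul_of_nonneg_left ?_ hK0.le) hK0.le
    linarith
  change ∑ σ, (1 - ‖a σ‖ ^ 2) ≤ K * ε
  rw [Finset.sum_sub_distrib, Finset.sum_const, nsmul_eq_mul, mul_one, Finset.card_univ]
  linarith

theorem pauliGate_mul_self (p : Pauli) : pauliGate p * pauliGate p = 1 :=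
  Subtype.ext (pauliMatrix_mul_self p)

theorem hadamardGate_mul_self : hadamardGate * hadamardGate = 1 := by
  have h1 := Matrix.mem_unitaryGroup_iff.mp hadamardMatrix_mem
  have h2 : star hadamardMatrix = hadamardMatrix := by
    rw [Matrix.star_eq_conjTranspose]
    ext i j
    fin_cases i <;> fin_cases j <;> simp [hadamardMatrix, Matrix.conjTranspose_apply]
  rw [h2] at h1
  exact Subtype.ext h1

theorem pauliZ_pow_zero_zero (k : ℕ) :
    (pauliGate (0, 1) ^ k : Gate).1 0 0 = 1 ∧ (pauliGate (0, 1) ^ k : Gate).1 0 1 = 0 := by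
  induction k with
  | zero => simp
  | succ k ih =>
    have h : ∀ i, (pauliGate (0, 1) ^ (k + 1) : Gate).1 0 i =
        ∑ l, (pauliGate (0, 1) ^ k : Gate).1 0 l * pauliMatrix (0, 1) l i := fun i => by
      rw [pow_succ]
      rfl
    rw [h, h, Fin.sum_univ_two, Fin.sum_univ_two, ih.1, ih.2]
    simp [pauliMatrix]

/-- The Pauli and Hadamard gates are involutions and cancel in the middle, leaving a power of `Z`,
which fixes `|0⟩`. This is why `0⋯0` is the correct outcome. -/
theorem trap_layers_mul (h : ℕ) (p : Pauli) (z z' : ℕ) :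
    (pauliGate (0, 1) ^ z' * hadamardGate ^ h * pauliGate p) *
      (pauliGate p * hadamardGate ^ h * pauliGate (0, 1) ^ z) = pauliGate (0, 1) ^ (z' + z) := by
  have h1 : hadamardGate ^ h * hadamardGate ^ h = 1 := by
    rw [← pow_add, ← two_mul, pow_mul, sq, hadamardGate_mul_self, one_pow]
  calc _ = pauliGate (0, 1) ^ z' * (hadamardGate ^ h * (pauliGate p * pauliGate p) *
        hadamardGate ^ h) * pauliGate (0, 1) ^ z := by simp only [mul_assoc]
    _ = _ := by rw [pauliGate_mul_self, mul_one, h1, mul_one, pow_add]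

theorem idealTrapFailure_le (hε : 0 < ε) : idealTrapFailure A ε G ≤ ε := by
  have hL := G.two_le_L
  have hne : Nonempty G.NonId := by
    rw [← Fintype.card_pos_iff, ← Nat.cast_pos (α := ℝ), G.card_nonId]
    linarith
  unfold idealTrapFailure average
  rw [div_le_iff₀ (Nat.cast_pos.mpr Fintype.card_pos), mul_comm]
  simp only [Fintype.sum_prod_type, Fintype.card_prod (α := _) (β := _), Nat.cast_mul, mul_assoc]
  refine (Finset.sum_le_card_nsmul _ _ _ fun h _ => Finset.sum_le_card_nsmul _ _ _ fun z _ =>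
    Finset.sum_le_card_nsmul _ _ _ fun P _ => Finset.sum_le_card_nsmul _ _ _ fun z' _ =>
    sum_one_sub_idealProb_le A ε G hε _ _ ?_).trans_eq ?_
  · simp only [trap_layers_mul, tensorOp, Matrix.of_apply]
    exact Finset.prod_eq_one fun j _ => (pauliZ_pow_zero_zero _).1
  · simp only [nsmul_eq_mul, Finset.card_univ]

end IdealTrap

/-! ### Actual executions -/

section Actual

variable {N : ℕ}

/-- Positivity is complete positivity with a one-dimensional ancilla. -/
theorem CPTPMap.posSemidef {n : Type} [Fintype n] (Φ : CPTPMap n) {ρ : Matrix n n ℂ}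
    (hρ : ρ.PosSemidef) : (Φ.toMap ρ).PosSemidef :=
  (Φ.completelyPositive 1 _ (hρ.submatrix Prod.fst)).submatrix fun i => (i, (0 : Fin 1))

theorem runParts_posSemidef {d : ℕ} (c : PauliString N → ℝ) (err : ℕ → CPTPMap (Reg N × Fin d))
    (l : List (HQSPart N)) (k : ℕ) {ρ : Matrix (Reg N × Fin d) (Reg N × Fin d) ℂ}
    (hρ : ρ.PosSemidef) : (runParts c err l k ρ).PosSemidef := by
  induction l generalizing k ρ with
  | nil => exact hρ
  | cons p l ih => exact ih _ ((err _).posSemidef (hρ.mul_mul_conjTranspose_same _))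

theorem runParts_trace {d : ℕ} (c : PauliString N → ℝ) (err : ℕ → CPTPMap (Reg N × Fin d))
    (l : List (HQSPart N)) (k : ℕ) (ρ : Matrix (Reg N × Fin d) (Reg N × Fin d) ℂ) :
    (runParts c err l k ρ).trace = ρ.trace := by
  induction l generalizing k ρ with
  | nil => rfl
  | cons p l ih =>
    rw [runParts, ih, (err _).tracePreserving, Matrix.trace_mul_cycle,
      Matrix.conjTranspose_kronecker, ← Matrix.mul_kronecker_mul, ← Matrix.star_eq_conjTranspose,
      Matrix.mem_unitaryGroup_iff'.mp (p.op_mem c), Matrix.conjTranspose_one, mul_one,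
      Matrix.one_kronecker_one, one_mul]

theorem finalState_posSemidef (C : HQS N) (E : ErrorProcess N) : (finalState C E).PosSemidef := by
  refine runParts_posSemidef _ _ _ _ ((E.err 0).posSemidef (Matrix.PosSemidef.kronecker ?_
    E.env_posSemidef))
  rw [← Matrix.diagonal_single]
  exact Matrix.PosSemidef.diagonal (Pi.single_nonneg.mpr zero_le_one)

theorem finalState_trace (C : HQS N) (E : ErrorProcess N) : (finalState C E).trace = 1 := by
  rw [finalState, runParts_trace, (E.err 0).tracePreserving, Matrix.trace_kronecker, E.env_trace,
    Matrix.trace_single_eq_same, one_mul]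

theorem actualProb_nonneg (C : HQS N) (E : ErrorProcess N) (s : Reg N) : 0 ≤ actualProb C E s :=
  Finset.sum_nonneg fun _ _ => (Complex.le_def.mp (finalState_posSemidef C E).diag_nonneg).1

theorem sum_actualProb (C : HQS N) (E : ErrorProcess N) : ∑ s, actualProb C E s = 1 := by
  have h := congrArg Complex.re (finalState_trace C E)
  rw [Matrix.trace, Complex.re_sum, Fintype.sum_prod_type] at h
  exact h

theorem idealProb_nonneg (C : HQS N) (s : Reg N) : 0 ≤ C.idealProb s := sq_nonneg _

theorem sum_idealProb (C : HQS N) : ∑ s, C.idealProb s = 1 := by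
  have h := congrFun (congrFun (Matrix.mem_unitaryGroup_iff'.mp (partsOp_mem C.coeff C.parts)) 0) 0
  rw [Matrix.mul_apply, Matrix.one_apply_eq] at h
  rw [← Complex.ofReal_inj, Complex.ofReal_sum, Complex.ofReal_one, ← h]
  refine Finset.sum_congr rfl fun s _ => ?_
  rw [HQS.idealProb, Matrix.star_apply, Complex.star_def, Complex.conj_mul', Complex.ofReal_pow]

/-- Both the terms off `a` together and the term at `a` are at most `(1 - p a) + (1 - q a)`; the
factor `1/2` turns the two copies into one. -/
theorem half_sum_abs_sub_le {ι : Type*} [Fintype ι] (a : ι) {p q : ι → ℝ}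
    (hp : ∀ s, 0 ≤ p s) (hq : ∀ s, 0 ≤ q s) (hp1 : ∑ s, p s = 1) (hq1 : ∑ s, q s = 1) :
    (1 / 2) * ∑ s, |p s - q s| ≤ (1 - p a) + (1 - q a) := by
  classical
  rw [← Finset.add_sum_erase _ _ (Finset.mem_univ a)] at hp1 hq1 ⊢
  have h1 : ∑ s ∈ Finset.univ.erase a, |p s - q s| ≤
      ∑ s ∈ Finset.univ.erase a, p s + ∑ s ∈ Finset.univ.erase a, q s := by
    rw [← Finset.sum_add_distrib]
    refine Finset.sum_le_sum fun s _ => abs_le.mpr ⟨?_, ?_⟩ <;> linarith [hp s, hq s]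
  have h2 : 0 ≤ ∑ s ∈ Finset.univ.erase a, p s := Finset.sum_nonneg fun s _ => hp s
  have h3 : 0 ≤ ∑ s ∈ Finset.univ.erase a, q s := Finset.sum_nonneg fun s _ => hq s
  have h4 : |p a - q a| ≤ (1 - p a) + (1 - q a) := by
    rw [abs_le]
    constructor <;> linarith
  linarith

theorem variationDistance_le (C : HQS N) (E : ErrorProcess N) :
    variationDistance C E ≤ (1 - C.idealProb 0) + (1 - actualProb C E 0) :=
  half_sum_abs_sub_le 0 (idealProb_nonneg C) (actualProb_nonneg C E) (sum_idealProb C)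
    (sum_actualProb C E)

theorem actualProb_le_one (C : HQS N) (E : ErrorProcess N) (s : Reg N) : actualProb C E s ≤ 1 := by
  rw [← sum_actualProb C E]
  exact Finset.single_le_sum (fun s _ => actualProb_nonneg C E s) (Finset.mem_univ s)

end Actual

/-! ### The bound on the variation distance of the target -/

section Bound

variable {N m : ℕ} (A : AQS N) (ε : ℝ) (G : InversionGroup A.coeff) (noise : Noise N m)

theorem meanVariationDistance_trap_le (i : Fin m) :
    meanVariationDistance noise (trapSimulation A ε G) i ≤
      trapFailure A ε G noise i + idealTrapFailure A ε G := by
  rw [meanVariationDistance, trapFailure, idealTrapFailure, average, average, average, ← add_div,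
    ← Finset.sum_add_distrib]
  gcongr
  rw [add_comm]
  exact variationDistance_le _ _

theorem trapFailure_nonneg (i : Fin m) : 0 ≤ trapFailure A ε G noise i :=
  div_nonneg (Finset.sum_nonneg fun _ _ => sub_nonneg.mpr (actualProb_le_one _ _ _))
    (Nat.cast_nonneg _)

theorem redact_blockSimulation (first last : Fin N → Gate)
    (g : Fin (numSteps A ε G) → Fin N → Option Gate) :
    (blockSimulation A ε G first last g).redact =
      ⟨A.coeff, [RedactedPart.gates fun _ => true, .evolve (G.t₁ A.t)] ++
        (List.ofFn fun k => [RedactedPart.gates fun j => (g k j).isSome,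
          .evolve (G.t₂ A.t / numSteps A ε G), .gates fun j => (g k j).isSome]).flatten ++
        [RedactedPart.gates fun _ => true]⟩ := by
  simp [blockSimulation, HQS.redact, HQSPart.redact, splitEvolution, List.map_flatten,
    List.map_ofFn, Function.comp_def]

theorem redact_trapSimulation (ω : TrapChoice A ε G) :
    (trapSimulation A ε G ω).redact =
      ⟨A.coeff, [RedactedPart.gates fun _ => true, .evolve (G.t₁ A.t)] ++
        (List.ofFn fun _ : Fin (numSteps A ε G) => [RedactedPart.gates fun _ => true,
          .evolve (G.t₂ A.t / numSteps A ε G), .gates fun _ => true]).flatten ++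
        [RedactedPart.gates fun _ => true]⟩ :=
  redact_blockSimulation A ε G _ _ _

theorem isReduced_split {n : ℕ} (τ : ℝ) {b b' : Fin n → Fin N → Bool}
    (h : ∀ k j, b' k j = true → b k j = true) :
    List.Forall₂ RedactedPart.IsReduced
      (List.ofFn fun k => [RedactedPart.gates (b' k), .evolve τ, .gates (b' k)]).flatten
      (List.ofFn fun k => [RedactedPart.gates (b k), .evolve τ, .gates (b k)]).flatten := by
  induction n with
  | zero => simp
  | succ n ih =>
    simp only [List.ofFn_succ, List.flatten_cons, List.cons_append, List.nil_append]
    exact .cons (h 0) (.cons rfl (.cons (h 0) (ih fun k => h k.succ)))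

/-- Trap layers carry a gate on every qubit, so the target arises by removing the gates around the
split evolutions, and E2 applies for every pair of slots. The target has no random gates, hence the
index type `Unit`. -/
theorem targetDistance_le_trap
    (hE2 : E2 noise (trapSimulation A ε G) (fun _ : Unit => targetSimulation A ε G))
    (τ i : Fin m) :
    targetDistance A ε G noise τ ≤ trapFailure A ε G noise i + idealTrapFailure A ε G := by
  refine le_trans ?_ (meanVariationDistance_trap_le A ε G noise i)
  have h : meanVariationDistance noise (fun _ : Unit => targetSimulation A ε G) τ =
      targetDistance A ε G noise τ := by
    simp [meanVariationDistance, average, targetDistance]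
  rw [← h]
  refine hE2 _ _ (redact_trapSimulation A ε G)
    (fun _ => redact_blockSimulation A ε G _ _ _) ⟨rfl, ?_⟩ i τ
  refine List.rel_append (List.rel_append ?_ (isReduced_split _ fun _ _ _ => rfl)) ?_
  · exact .cons (fun _ h => h) (.cons rfl .nil)
  · exact .cons (fun _ h => h) .nil

theorem targetDistance_le_expectedBound (hm : 2 ≤ m)
    (hE2 : E2 noise (trapSimulation A ε G) (fun _ : Unit => targetSimulation A ε G))
    (τ : Fin m) :
    targetDistance A ε G noise τ ≤ expectedBound A ε G noise τ + idealTrapFailure A ε G := by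
  have hm2 : (2 : ℝ) ≤ m := by exact_mod_cast hm
  have h1 := Finset.card_nsmul_le_sum (Finset.univ.erase τ) (trapFailure A ε G noise)
    (targetDistance A ε G noise τ - idealTrapFailure A ε G) fun i _ => by
      linarith [targetDistance_le_trap A ε G noise hE2 τ i]
  have h0 : 0 ≤ ∑ i ∈ Finset.univ.erase τ, trapFailure A ε G noise i :=
    Finset.sum_nonneg fun i _ => trapFailure_nonneg A ε G noise i
  rw [Finset.card_erase_of_mem (Finset.mem_univ τ), Finset.card_univ, Fintype.card_fin,
    nsmul_eq_mul, Nat.cast_sub (by omega), Nat.cast_one] at h1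
  rw [← sub_le_iff_le_add, expectedBound, le_div_iff₀ (by linarith)]
  -- Summing over the `m - 1` traps gives a factor `m - 1` where `m / 2` is needed; `m / 2 ≤ m - 1`
  -- helps only if the difference is positive, and otherwise nonnegativity of the failures suffices.
  rcases le_or_gt (targetDistance A ε G noise τ - idealTrapFailure A ε G) 0 with h | h
  · nlinarith
  · nlinarith

end Bound

/-! ### Hoeffding's inequality for finite product distributions -/

section Hoeffding

theorem sum_mul_exp_le_of_mem_Icc {X : Type*} [Fintype X] {w f : X → ℝ} (hw : ∀ x, 0 ≤ w x)
    (hw1 : ∑ x, w x = 1) (hf : ∀ x, f x ∈ Set.Icc (0 : ℝ) 1) (t : ℝ) :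
    ∑ x, w x * Real.exp (t * (f x - ∑ y, w y * f y)) ≤ Real.exp (t ^ 2 / 8) := by
  let _ : MeasurableSpace X := ⊤
  let p : PMF X := PMF.ofFintype (fun x => ENNReal.ofReal (w x)) (by
    rw [← ENNReal.ofReal_sum_of_nonneg fun x _ => hw x, hw1, ENNReal.ofReal_one])
  have hp : ∀ x, (p x).toReal = w x := fun x => ENNReal.toReal_ofReal (hw x)
  have h := (ProbabilityTheory.hasSubgaussianMGF_of_mem_Icc (μ := p.toMeasure) (X := f)
    (a := 0) (b := 1) (measurable_of_finite f).aemeasurable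
    (Filter.Eventually.of_forall hf)).mgf_le t
  rw [ProbabilityTheory.mgf, PMF.integral_eq_sum, PMF.integral_eq_sum] at h
  simp only [hp, smul_eq_mul] at h
  -- Values in an interval of length `1` give the variance proxy `1/4`, hence the exponent `t ^ 2 /
  -- 8`.
  refine h.trans_eq ?_
  congr 1
  simp
  ring

variable {ι X : Type*} [Fintype ι] [DecidableEq ι] [Fintype X] {w f : ι → X → ℝ}

theorem sum_prod_mul_exp_le (hw : ∀ i x, 0 ≤ w i x) (hw1 : ∀ i, ∑ x, w i x = 1)
    (hf : ∀ i x, f i x ∈ Set.Icc (0 : ℝ) 1) (t : ℝ) :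
    ∑ x : ι → X, (∏ i, w i (x i)) * Real.exp (t * ∑ i, (f i (x i) - ∑ y, w i y * f i y)) ≤
      Real.exp (Fintype.card ι * (t ^ 2 / 8)) := by
  have h : ∀ x : ι → X,
      (∏ i, w i (x i)) * Real.exp (t * ∑ i, (f i (x i) - ∑ y, w i y * f i y)) =
        ∏ i, w i (x i) * Real.exp (t * (f i (x i) - ∑ y, w i y * f i y)) := fun x => by
    rw [Finset.mul_sum, Real.exp_sum, Finset.prod_mul_distrib]
  simp only [h]
  rw [← Fintype.piFinset_univ, ← Finset.prod_univ_sum (fun _ => Finset.univ)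
    (fun i y => w i y * Real.exp (t * (f i y - ∑ y, w i y * f i y)))]
  refine (Finset.prod_le_prod (fun i _ => Finset.sum_nonneg fun x _ =>
    mul_nonneg (hw i x) (Real.exp_pos _).le) fun i _ =>
      sum_mul_exp_le_of_mem_Icc (hw i) (hw1 i) (hf i) t).trans_eq ?_
  rw [Finset.prod_const, Finset.card_univ, Real.exp_nat_mul]

theorem sum_prod_eq_one (hw1 : ∀ i, ∑ x, w i x = 1) : ∑ x : ι → X, ∏ i, w i (x i) = 1 := by
  rw [← Fintype.piFinset_univ, ← Finset.prod_univ_sum (fun _ => Finset.univ) w]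
  exact Finset.prod_eq_one fun i _ => hw1 i

/-- Chernoff's method for both tails at once: outside the event the deviation `D` satisfies `|D| >
s`, so `(e^{tD} + e^{-tD}) e^{-ts} ≥ 1` there. The factors need not be identically distributed. -/
theorem one_sub_le_sum_prod [Nonempty ι] (hw : ∀ i x, 0 ≤ w i x) (hw1 : ∀ i, ∑ x, w i x = 1)
    (hf : ∀ i x, f i x ∈ Set.Icc (0 : ℝ) 1) {s : ℝ} (hs : 0 ≤ s) {event : (ι → X) → Prop}
    [DecidablePred event]
    (hevent : ∀ x, |∑ i, (f i (x i) - ∑ y, w i y * f i y)| ≤ s → event x) :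
    1 - 2 * Real.exp (-(2 * s ^ 2 / Fintype.card ι)) ≤
      ∑ x : ι → X, if event x then ∏ i, w i (x i) else 0 := by
  set n : ℝ := (Fintype.card ι : ℝ) with hn
  have hn0 : 0 < n := Nat.cast_pos.mpr Fintype.card_pos
  -- The minimiser of `n * t ^ 2 / 8 - t * s`, with minimum `-2 * s ^ 2 / n`.
  set t := 4 * s / n with ht
  have ht0 : 0 ≤ t := by positivity
  have e1 := sum_prod_mul_exp_le hw hw1 hf t
  have e2 := sum_prod_mul_exp_le hw hw1 hf (-t)
  have hexp : Real.exp (-(2 * s ^ 2 / n)) = Real.exp (n * (t ^ 2 / 8)) * Real.exp (-(t * s)) := by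
    rw [← Real.exp_add, ht]
    congr 1
    field_simp
    ring
  have key : ∀ x : ι → X, (∏ i, w i (x i)) ≤ (if event x then ∏ i, w i (x i) else 0) +
      ((∏ i, w i (x i)) * Real.exp (t * ∑ i, (f i (x i) - ∑ y, w i y * f i y)) +
        (∏ i, w i (x i)) * Real.exp (-t * ∑ i, (f i (x i) - ∑ y, w i y * f i y))) *
          Real.exp (-(t * s)) := fun x => by
    have hW : 0 ≤ ∏ i, w i (x i) := Finset.prod_nonneg fun i _ => hw i _
    set D := ∑ i, (f i (x i) - ∑ y, w i y * f i y)
    by_cases hx : event x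
    · rw [if_pos hx]
      exact le_add_of_nonneg_right (by positivity)
    · rw [if_neg hx, zero_add, ← mul_add, mul_assoc, add_mul, ← Real.exp_add, ← Real.exp_add]
      refine le_mul_of_one_le_right hW ?_
      have hD : s < |D| := lt_of_not_ge fun h => hx (hevent x h)
      rcases lt_abs.mp hD with h | h
      · have : 1 ≤ Real.exp (t * D + -(t * s)) := Real.one_le_exp (by nlinarith)
        linarith [Real.exp_pos (-t * D + -(t * s))]
      · have : 1 ≤ Real.exp (-t * D + -(t * s)) := Real.one_le_exp (by nlinarith)
        linarith [Real.exp_pos (t * D + -(t * s))]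
  have hsum := Finset.sum_le_sum fun x (_ : x ∈ (Finset.univ : Finset (ι → X))) => key x
  rw [sum_prod_eq_one hw1, Finset.sum_add_distrib, ← Finset.sum_mul, Finset.sum_add_distrib] at hsum
  rw [neg_sq] at e2
  have h3 := mul_le_mul_of_nonneg_right (add_le_add e1 e2) (Real.exp_pos (-(t * s))).le
  rw [hexp]
  linarith

end Hoeffding

/-! ### The protocol -/

section Protocol

variable {N m : ℕ} (A : AQS N) (ε : ℝ) (G : InversionGroup A.coeff) (noise : Noise N m)

theorem card_trapChoice_pos : (0 : ℝ) < Fintype.card (TrapChoice A ε G) := by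
  have hL := G.two_le_L
  have hne : Nonempty G.NonId := by
    rw [← Fintype.card_pos_iff, ← Nat.cast_pos (α := ℝ), G.card_nonId]
    linarith
  exact Nat.cast_pos.mpr Fintype.card_pos

/-- The joint distribution of the random choices and the outcome in slot `i` when the target is in
slot `τ`. -/
noncomputable def slotWeight (τ i : Fin m) (x : TrapChoice A ε G × Reg N) : ℝ :=
  1 / (Fintype.card (TrapChoice A ε G) : ℝ) *
    actualProb (if i = τ then targetSimulation A ε G else trapSimulation A ε G x.1)
      (noise i (if i = τ then targetSimulation A ε G else trapSimulation A ε G x.1)) x.2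

/-- Indicator of an incorrect trap in slot `i`. -/
noncomputable def slotFailure (τ i : Fin m) (x : TrapChoice A ε G × Reg N) : ℝ :=
  if i ≠ τ ∧ x.2 ≠ 0 then 1 else 0

theorem slotWeight_nonneg (τ i : Fin m) (x : TrapChoice A ε G × Reg N) :
    0 ≤ slotWeight A ε G noise τ i x :=
  mul_nonneg (by positivity) (actualProb_nonneg _ _ _)

theorem sum_slotWeight (τ i : Fin m) : ∑ x, slotWeight A ε G noise τ i x = 1 := by
  have h := card_trapChoice_pos A ε G
  rw [Fintype.sum_prod_type]
  simp only [slotWeight, ← Finset.mul_sum, sum_actualProb]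
  rw [Finset.sum_const, Finset.card_univ, nsmul_eq_mul, mul_one, one_div_mul_cancel h.ne']

theorem slotFailure_mem (τ i : Fin m) (x : TrapChoice A ε G × Reg N) :
    slotFailure A ε G τ i x ∈ Set.Icc (0 : ℝ) 1 := by
  unfold slotFailure
  split_ifs <;> simp

/-- The slot of the target takes part in the product distribution with the constant value `0`, so
Hoeffding's inequality can run over all `m` slots. -/
theorem sum_slotWeight_mul_slotFailure (τ i : Fin m) :
    ∑ x, slotWeight A ε G noise τ i x * slotFailure A ε G τ i x =
      if i ≠ τ then trapFailure A ε G noise i else 0 := by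
  by_cases hi : i = τ
  · simp [slotFailure, hi]
  rw [if_pos hi, Fintype.sum_prod_type, trapFailure, average, Finset.sum_div]
  refine Finset.sum_congr rfl fun ω _ => ?_
  simp only [slotWeight, slotFailure, if_neg hi]
  have h1 := sum_actualProb (trapSimulation A ε G ω) (noise i (trapSimulation A ε G ω))
  rw [← Finset.add_sum_erase _ _ (Finset.mem_univ (0 : Reg N))] at h1 ⊢
  rw [← eq_sub_iff_add_eq'.mpr h1, Finset.sum_div]
  simp only [ne_eq, hi, not_false_eq_true, not_true, and_false, if_false, mul_zero, zero_add,
    true_and]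
  refine Finset.sum_congr rfl fun s hs => ?_
  rw [if_pos (Finset.ne_of_mem_erase hs)]
  ring

theorem epsVD_eq (r : Run A ε G m) :
    r.epsVD = 2 * (∑ i, slotFailure A ε G r.1 i (r.2 i)) / m := by
  have h : (r.incorrectTraps.card : ℝ) = ∑ i, slotFailure A ε G r.1 i (r.2 i) := by
    simp only [slotFailure]
    rw [Finset.sum_boole]
    congr 2
    ext i
    rw [Run.incorrectTraps, Finset.mem_filter, Run.trapSlots, Finset.mem_erase]
    simp [Run.targetSlot, Run.outcome]
  rw [Run.epsVD, h]

theorem expectedBound_eq (τ : Fin m) :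
    expectedBound A ε G noise τ =
      2 * (∑ i, ∑ x, slotWeight A ε G noise τ i x * slotFailure A ε G τ i x) / m := by
  simp only [sum_slotWeight_mul_slotFailure]
  rw [← Finset.sum_filter, expectedBound, Finset.filter_ne']

theorem weight_eq (r : Run A ε G m) :
    r.weight noise = (1 / (m : ℝ)) * ∏ i, slotWeight A ε G noise r.1 i (r.2 i) := rfl

/-- Given `τ`, the slots are independent and Hoeffding's bound does not depend on `τ`; it therefore
survives averaging over the uniform slot. -/
theorem le_runProbability (hm : 0 < m) {θ : ℝ} (hθ : 0 ≤ θ) {event : Run A ε G m → Prop}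
    (hevent : ∀ r : Run A ε G m,
      |r.epsVD - expectedBound A ε G noise r.targetSlot| ≤ θ → event r) :
    1 - 2 * Real.exp (-(m * θ ^ 2 / 2)) ≤ runProbability A ε G noise event := by
  classical
  have hm0 : (0 : ℝ) < m := Nat.cast_pos.mpr hm
  have : Nonempty (Fin m) := ⟨⟨0, hm⟩⟩
  have key : ∀ τ : Fin m, 1 - 2 * Real.exp (-(m * θ ^ 2 / 2)) ≤
      ∑ x : Fin m → TrapChoice A ε G × Reg N,
        if event (τ, x) then ∏ i, slotWeight A ε G noise τ i (x i) else 0 := fun τ => by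
    have h := one_sub_le_sum_prod (slotWeight_nonneg A ε G noise τ) (sum_slotWeight A ε G noise τ)
      -- The returned bound is `2 / m` times the number of failures, so accuracy `θ` for it is
      -- accuracy `θ * m / 2` for the count.
      (slotFailure_mem A ε G τ) (s := θ * m / 2) (by positivity) (event := fun x => event (τ, x))
      fun x hx => hevent (τ, x) (by
        rw [epsVD_eq, expectedBound_eq, ← sub_div, ← mul_sub, abs_div, abs_mul, abs_two,
          abs_of_pos hm0, div_le_iff₀ hm0]
        rw [Finset.sum_sub_distrib] at hx
        have hx' : |∑ i, slotFailure A ε G τ i (x i) -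
          ∑ i, ∑ y, slotWeight A ε G noise τ i y * slotFailure A ε G τ i y| ≤ θ * m / 2 := hx
        change 2 * |∑ i, slotFailure A ε G τ i (x i) -
          ∑ i, ∑ y, slotWeight A ε G noise τ i y * slotFailure A ε G τ i y| ≤ θ * m
        linarith)
    have he : 2 * (θ * m / 2) ^ 2 / (Fintype.card (Fin m) : ℝ) = m * θ ^ 2 / 2 := by
      rw [Fintype.card_fin]
      field_simp
    rw [he] at h
    convert h
  have hsum : runProbability A ε G noise event = ∑ τ : Fin m, (1 / (m : ℝ)) *
      ∑ x : Fin m → TrapChoice A ε G × Reg N,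
        if event (τ, x) then ∏ i, slotWeight A ε G noise τ i (x i) else 0 := by
    rw [runProbability, Fintype.sum_prod_type]
    refine Finset.sum_congr rfl fun τ _ => ?_
    rw [Finset.mul_sum]
    refine Finset.sum_congr rfl fun x _ => ?_
    rw [weight_eq, mul_ite, mul_zero]
  rw [hsum, ← Finset.mul_sum, one_div, le_inv_mul_iff₀ hm0]
  refine le_trans ?_ (Finset.card_nsmul_le_sum _ _ _ fun τ _ => key τ)
  rw [Finset.card_univ, Fintype.card_fin, nsmul_eq_mul]

theorem card_trapSlots {m : ℕ} {A : AQS N} {ε : ℝ} {G : InversionGroup A.coeff}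
    (r : Run A ε G (m + 1)) : r.trapSlots.card = m := by
  rw [Run.trapSlots, Finset.card_erase_of_mem (Finset.mem_univ _), Finset.card_univ,
    Fintype.card_fin, Nat.add_sub_cancel]

theorem epsVD_mem {m : ℕ} {A : AQS N} {ε : ℝ} {G : InversionGroup A.coeff}
    (r : Run A ε G (m + 1)) : r.epsVD ∈ Set.Ico (0 : ℝ) 2 := by
  refine ⟨by unfold Run.epsVD; positivity, ?_⟩
  have h : r.incorrectTraps.card ≤ m :=
    (Finset.card_filter_le _ _).trans_eq (card_trapSlots r)
  have h2 : (r.incorrectTraps.card : ℝ) ≤ m := by exact_mod_cast h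
  rw [Run.epsVD, div_lt_iff₀ (by positivity)]
  push_cast
  linarith

theorem log_two_div_nonneg {α : ℝ} (hα : α ∈ Set.Ico (0 : ℝ) 1) :
    0 ≤ Real.log (2 / (1 - α)) := by
  refine Real.log_nonneg ?_
  rw [le_div_iff₀ (by linarith [hα.2])]
  linarith [hα.1]

theorem le_one_sub_exp_numTraps {θ α : ℝ} (hθ : 0 < θ) (hα : α ∈ Set.Ico (0 : ℝ) 1) :
    α ≤ 1 - 2 * Real.exp (-(((numTraps θ α + 1 : ℕ) : ℝ) * θ ^ 2 / 2)) := by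
  have h1 : 2 / θ ^ 2 * Real.log (2 / (1 - α)) ≤ ((numTraps θ α + 1 : ℕ) : ℝ) := by
    refine (Nat.le_ceil _).trans ?_
    rw [numTraps]
    push_cast
    linarith
  have h2 : Real.log (2 / (1 - α)) ≤ ((numTraps θ α + 1 : ℕ) : ℝ) * θ ^ 2 / 2 := by
    have h3 := mul_le_mul_of_nonneg_right h1 (by positivity : 0 ≤ θ ^ 2 / 2)
    have h4 : 2 / θ ^ 2 * Real.log (2 / (1 - α)) * (θ ^ 2 / 2) = Real.log (2 / (1 - α)) := by
      field_simp
    linarith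
  have h0 : 0 < 1 - α := by linarith [hα.2]
  have h5 : Real.exp (-(((numTraps θ α + 1 : ℕ) : ℝ) * θ ^ 2 / 2)) ≤ (1 - α) / 2 := by
    refine (Real.exp_le_exp.mpr (neg_le_neg h2)).trans_eq ?_
    rw [Real.exp_neg, Real.exp_log (by positivity), inv_div]
  linarith

end Protocol

end AnalogueAccreditation

/-! ### Accredited analogue simulation: assembly -/

theorem mainTheorem1 {N : ℕ} (hN : 0 < N) (A : AQS N) (ε θ α : ℝ) (hε : 0 < ε)
    (hθ : θ ∈ Set.Ioo (0 : ℝ) 1) (hα : α ∈ Set.Ico (0 : ℝ) 1) :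
    -- a group as needed for the inversion exists, and the protocol works with any of them
    Nonempty (InversionGroup A.coeff) ∧
    ∀ G : InversionGroup A.coeff,
      -- the target simulation implements the given analogue simulation
      (∀ s, (targetSimulation A ε G).idealProb s = A.prob s) ∧
      -- without errors, traps fail with probability at most `ε`
      idealTrapFailure A ε G ≤ ε ∧
      ∀ noise : Noise N (numTraps θ α + 1),
        E2 noise (trapSimulation A ε G) (fun _ : Unit => targetSimulation A ε G) →
        E3 noise →
        -- number of traps and range of the returned bound
        (∀ r : Run A ε G (numTraps θ α + 1),
          (r.trapSlots.card : ℤ) = ⌈2 / θ ^ 2 * Real.log (2 / (1 - α))⌉ + 1 ∧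
          r.epsVD ∈ Set.Ico (0 : ℝ) 2) ∧
        -- what is estimated is an upper bound
        (∀ τ, targetDistance A ε G noise τ ≤
          expectedBound A ε G noise τ + idealTrapFailure A ε G) ∧
        -- accuracy `θ` and confidence `α`
        α ≤ runProbability A ε G noise (fun r =>
          |r.epsVD - expectedBound A ε G noise r.targetSlot| ≤ θ ∧
          targetDistance A ε G noise r.targetSlot ≤ r.epsVD + θ + idealTrapFailure A ε G) := by
  refine ⟨nonempty_inversionGroup hN _, fun G => ⟨targetSimulation_idealProb A ε G hε,
    idealTrapFailure_le A ε G hε, fun noise hE2 _ => ?_⟩⟩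
  have hbound := targetDistance_le_expectedBound A ε G noise
    (by unfold numTraps; omega) hE2
  refine ⟨fun r => ⟨?_, epsVD_mem r⟩, hbound, ?_⟩
  -- Nonnegativity makes the natural-number ceiling agree with the integer one.
  · have h0 : 0 ≤ 2 / θ ^ 2 * Real.log (2 / (1 - α)) :=
      mul_nonneg (by positivity) (log_two_div_nonneg hα)
    rw [card_trapSlots, numTraps, Nat.cast_succ, Int.natCast_ceil_eq_ceil h0]
  · refine (le_one_sub_exp_numTraps hθ.1 hα).trans
      (le_runProbability A ε G noise (Nat.succ_pos _) hθ.1.le fun r hr => ⟨hr, ?_⟩)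
    have h1 := hbound r.targetSlot
    have h2 := (abs_le.mp hr).1
    linarith
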